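/- Two content providers, $1$ and $2$, share a cache. Let $b_0,b_1,b_2$ be positive integers. In the $n$-th system there are a set $S_0$ of $b_0n$ files served by both providers and sets $S_1$, $S_2$ of $b_1n$, respectively $b_2n$, files served only by provider $1$, respectively $2$. Requests to $S_0$ through provider $k$ have rate $\lambda_{0,k}>0$ and requests to $S_k$ have rate $\lambda_k>0$ ($k=1,2$). A request to $S_0$ through provider $k$ is for its $i$-th file with probability $F_{0,k}(\frac{i}{b_0n})-F_{0,k}(\frac{i-1}{b_0n})$, and a request to $S_k$ is for its $i$-th file with probability $F_k(\frac{i}{b_kn})-F_k(\frac{i-1}{b_kn})$. Here $F_{0,1},F_{0,2},F_1,F_2:[0,1]\to[0,1]$ are nondecreasing and continuous, with value $0$ at $0$ and $1$ at $1$, and are continuously differentiable in $(0,1)$ except possibly at countably many points (the derivative may be unbounded near $0$). Successive requests are independent, so each is for a given file with probability equal to the total request rate of that file divided by $\lambda_{0,1}+\lambda_{0,2}+\lambda_1+\lambda_2$. The aggregate miss probability is the steady-state probability that a request is not found in the cache. One stored copy of a file of $S_0$ serves both providers. Strategy 1 uses one LRU cache of size $C^{(n)}$ for all files. Strategy 3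 uses three separate LRU slices of sizes $C_0^{(n)},C_1^{(n)},C_2^{(n)}$, one for each of $S_0,S_1,S_2$. Let $\beta\ge 0$. Then: (i) the aggregate miss probability under Strategy 1 with integer cache sizes $C^{(n)}$, $C^{(n)}/n\to\beta$, converges as $n\to\infty$ to a limit $\mu^{(1)}$ that does not depend on the choice of the sizes $C^{(n)}$; (ii) for all $s_0,s_1,s_2\ge0$ the aggregate miss probability under Strategy 3 with integer slice sizes $C_k^{(n)}$, $C^{(n)}_k/n\to s_k$ ($k=0,1,2$), converges to a limit $\mu^{(3)}(s_0,s_1,s_2)$ that does not depend on the choice of the sizes $C_k^{(n)}$; (iii) the minimum of $\mu^{(3)}(s_0,s_1,s_2)$ over all $s_0,s_1,s_2\ge 0$ with $s_0+s_1+s_2\le\beta$ is attained and is at most $\mu^{(1)}$. -/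

import Mathlib

open Filter Topology

noncomputable section

/-! ### Partitioned LRU caches fed by independent requests -/

/-- One step of the LRU policy with capacity `C`. The cache content is listed from the most
recently to the least recently requested file; the requested file `x` moves (or enters) to the
front, and the least recently requested file is evicted when the capacity is exceeded. -/
def lruStep {ι : Type*} [DecidableEq ι] (C : ℕ) (cache : List ι) (x : ι) : List ι :=
  (x :: cache.erase x).take C

/-- One step of a cache that is split into slices indexed by `P`: the slice `q` has capacity
`C q`, runs LRU on its own, and serves exactly the files `x` with `part x = q`. -/
def cacheStep {ι P : Type*} [DecidableEq ι] [DecidableEq P] (part : ι → P) (C : P → ℕ)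
    (state : P → List ι) (x : ι) : P → List ι :=
  Function.update state (part x) (lruStep (C (part x)) (state (part x)) x)

/-- The content of the slices after the requests in the list `ω` (oldest request first), starting
from empty slices. -/
def cacheAfter {ι P : Type*} [DecidableEq ι] [DecidableEq P] (part : ι → P) (C : P → ℕ)
    (ω : List ι) : P → List ι :=
  ω.foldl (cacheStep part C) (fun _ => [])

/-- The probability that a request misses, when it is preceded by `N` requests and all requests
are independent, each being for file `x` with probability `p x`. -/
def missAt {ι P : Type*} [Fintype ι] [DecidableEq ι] [DecidableEq P] (part : ι → P) (C : P → ℕ)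
    (p : ι → ℝ) (N : ℕ) : ℝ :=
  ∑ ω : Fin N → ι, ∑ x : ι, (∏ j, p (ω j)) * p x *
    (if x ∈ cacheAfter part C (List.ofFn ω) (part x) then 0 else 1)

/-- The (steady-state, aggregate) LRU miss probability. The limit exists,
see `tendsto_missAt`. -/
def missProb {ι P : Type*} [Fintype ι] [DecidableEq ι] [DecidableEq P] (part : ι → P) (C : P → ℕ)
    (p : ι → ℝ) : ℝ :=
  limUnder atTop (missAt part C p)

theorem lruStep_prefix {ι : Type*} [DecidableEq ι] (C : ℕ) {c d : List ι} (h : c <+: d) (x : ι) :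
    lruStep C c x <+: lruStep C d x := by
  obtain ⟨e, rfl⟩ := h
  unfold lruStep
  apply List.IsPrefix.take
  rw [List.prefix_cons_inj, List.erase_append]
  split_ifs with hx
  · exact List.prefix_append _ _
  · rw [List.erase_of_not_mem hx]; exact List.prefix_append _ _

theorem foldl_cacheStep_prefix {ι P : Type*} [DecidableEq ι] [DecidableEq P] (part : ι → P)
    (C : P → ℕ) (ω : List ι) : ∀ (s t : P → List ι), (∀ q, s q <+: t q) →
    ∀ q, ω.foldl (cacheStep part C) s q <+: ω.foldl (cacheStep part C) t q := by
  induction ω with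
  | nil => intro s t h; exact h
  | cons x ω ih =>
    intro s t h
    refine ih _ _ fun q => ?_
    by_cases hq : q = part x
    · subst hq; simpa [cacheStep] using lruStep_prefix _ (h _) x
    · simpa [cacheStep, hq] using h q

theorem missAt_nonneg {ι P : Type*} [Fintype ι] [DecidableEq ι] [DecidableEq P] (part : ι → P)
    (C : P → ℕ) (p : ι → ℝ) (hp : ∀ x, 0 ≤ p x) (N : ℕ) : 0 ≤ missAt part C p N := by
  refine Finset.sum_nonneg fun ω _ => Finset.sum_nonneg fun x _ => ?_
  refine mul_nonneg (mul_nonneg (Finset.prod_nonneg fun j _ => hp _) (hp x)) ?_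
  split_ifs <;> norm_num

theorem missAt_antitone {ι P : Type*} [Fintype ι] [DecidableEq ι] [DecidableEq P] (part : ι → P)
    (C : P → ℕ) (p : ι → ℝ) (hp : ∀ x, 0 ≤ p x) (h1 : ∑ x, p x = 1) :
    Antitone (missAt part C p) := by
  refine antitone_nat_of_succ_le fun N => ?_
  unfold missAt
  rw [← (Fin.consEquiv (fun _ : Fin (N + 1) => ι)).sum_comp, Fintype.sum_prod_type]
  have key : ∀ y : ι, (∑ ω : Fin N → ι, ∑ x : ι,
      (∏ j, p ((Fin.consEquiv (fun _ : Fin (N + 1) => ι)) (y, ω) j)) * p x *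
        (if x ∈ cacheAfter part C
          (List.ofFn ((Fin.consEquiv (fun _ : Fin (N + 1) => ι)) (y, ω))) (part x)
          then 0 else 1)) ≤ p y * missAt part C p N := by
    intro y
    unfold missAt
    rw [Finset.mul_sum]
    refine Finset.sum_le_sum fun ω _ => ?_
    rw [Finset.mul_sum]
    refine Finset.sum_le_sum fun x _ => ?_
    have e : (Fin.consEquiv (fun _ : Fin (N + 1) => ι)) (y, ω) = Fin.cons y ω := rfl
    rw [e, Fin.prod_univ_succ, List.ofFn_succ]
    simp only [Fin.cons_zero, Fin.cons_succ]
    have hpre := foldl_cacheStep_prefix part C (List.ofFn ω) (fun _ => [])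
      (cacheStep part C (fun _ => []) y) (fun q => List.nil_prefix) (part x)
    have hA : 0 ≤ (∏ j, p (ω j)) * p x := mul_nonneg (Finset.prod_nonneg fun j _ => hp _) (hp x)
    have hle : (if x ∈ cacheAfter part C (y :: List.ofFn ω) (part x) then (0 : ℝ) else 1) ≤
        (if x ∈ cacheAfter part C (List.ofFn ω) (part x) then 0 else 1) := by
      by_cases hx : x ∈ cacheAfter part C (List.ofFn ω) (part x)
      · have : x ∈ cacheAfter part C (y :: List.ofFn ω) (part x) := hpre.subset hx
        simp [hx, this]
      · simp only [hx, if_false]; split_ifs <;> norm_num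
    have := mul_le_mul_of_nonneg_left hle (mul_nonneg (hp y) hA)
    calc _ = p y * ((∏ j, p (ω j)) * p x) *
          (if x ∈ cacheAfter part C (y :: List.ofFn ω) (part x) then (0 : ℝ) else 1) := by ring
      _ ≤ _ := this
      _ = _ := by ring
  refine (Finset.sum_le_sum fun y _ => key y).trans ?_
  rw [← Finset.sum_mul, h1, one_mul]
  rfl

/-- The limit that defines the miss probability exists. -/
theorem tendsto_missAt {ι P : Type*} [Fintype ι] [DecidableEq ι] [DecidableEq P] (part : ι → P)
    (C : P → ℕ) (p : ι → ℝ) (hp : ∀ x, 0 ≤ p x) (h1 : ∑ x, p x = 1) :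
    Tendsto (missAt part C p) atTop (𝓝 (missProb part C p)) :=
  tendsto_nhds_limUnder ⟨_, tendsto_atTop_ciInf (missAt_antitone part C p hp h1)
    ⟨0, by rintro _ ⟨N, rfl⟩; exact missAt_nonneg part C p hp N⟩⟩

/-! ### Asymptotic popularity distributions -/

/-- A continuous cumulative distribution function of a probability on `[0, 1]` that is continuously
differentiable in `(0, 1)`, except possibly at countably many points. Nothing is assumed about the
derivative near the endpoints, where it may be infinite. -/
structure IsPopularityCDF (F : ℝ → ℝ) : Prop where
  monotoneOn : MonotoneOn F (Set.Icc 0 1)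
  continuousOn : ContinuousOn F (Set.Icc 0 1)
  map_zero : F 0 = 0
  map_one : F 1 = 1
  contDiff_off_countable : ∃ D : Set ℝ, D.Countable ∧
    (∀ x ∈ Set.Ioo (0 : ℝ) 1 \ D, DifferentiableAt ℝ F x) ∧
    ContinuousOn (deriv F) (Set.Ioo (0 : ℝ) 1 \ D)

/-- The probability of the `i`-th of `m` files under `F`: with files labelled `1, …, m` this is
`F (i / m) - F ((i - 1) / m)`; here labels start from `0`. -/
def popularity (F : ℝ → ℝ) (m : ℕ) (i : Fin m) : ℝ :=
  F (((i : ℕ) + 1 : ℝ) / m) - F (((i : ℕ) : ℝ) / m)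

/-! ### Two providers with common files -/

/-- Two providers (indexed by `Fin 2`) with a set `S 0` of shared files and sets `S 1`, `S 2` of
files served only by the first, respectively second, provider; `S k` has `b k * n` files. Requests
to shared files through provider `j` have rate `sharedRate j` and popularity distribution
`sharedCDF j`, requests to private files of provider `j` have rate `privateRate j` and popularity
distribution `privateCDF j`. -/
structure Workload where
  b : Fin 3 → ℕ
  b_pos : ∀ k, 0 < b k
  sharedRate : Fin 2 → ℝ
  sharedRate_pos : ∀ j, 0 < sharedRate j
  privateRate : Fin 2 → ℝ
  privateRate_pos : ∀ j, 0 < privateRate j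
  sharedCDF : Fin 2 → ℝ → ℝ
  sharedCDF_spec : ∀ j, IsPopularityCDF (sharedCDF j)
  privateCDF : Fin 2 → ℝ → ℝ
  privateCDF_spec : ∀ j, IsPopularityCDF (privateCDF j)

namespace Workload

/-- The files in the `n`-th system: `⟨k, i⟩` is the file with label `i` of `S k`. -/
abbrev File (W : Workload) (n : ℕ) : Type := Σ k : Fin 3, Fin (W.b k * n)

/-- The request rate of a file in the `n`-th system, summed over the providers that serve it. -/
def fileRate (W : Workload) (n : ℕ) : W.File n → ℝ
  | ⟨0, i⟩ => ∑ j, W.sharedRate j * popularity (W.sharedCDF j) (W.b 0 * n) i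
  | ⟨1, i⟩ => W.privateRate 0 * popularity (W.privateCDF 0) (W.b 1 * n) i
  | ⟨2, i⟩ => W.privateRate 1 * popularity (W.privateCDF 1) (W.b 2 * n) i

/-- The rate of all requests together. -/
def totalRate (W : Workload) : ℝ := ∑ j, (W.sharedRate j + W.privateRate j)

/-- The probability that a request is for a given file. In the superposition of independent
Poisson request streams successive requests are independent with this law. -/
def fileProb (W : Workload) (n : ℕ) (f : W.File n) : ℝ := W.fileRate n f / W.totalRate

/-- Strategy 1: aggregate LRU miss probability in the `n`-th system when all files share a
single cache of size `C`. -/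
def missStrategy1 (W : Workload) (n C : ℕ) : ℝ :=
  missProb (fun _ : W.File n => ()) (fun _ => C) (W.fileProb n)

/-- Strategy 3: aggregate LRU miss probability in the `n`-th system when, for each `k`, the files
in `S k` have their own slice of size `c k`. In particular the slice for `S 0` is used by both
providers. -/
def missStrategy3 (W : Workload) (n : ℕ) (c : Fin 3 → ℕ) : ℝ :=
  missProb (fun f : W.File n => f.1) c (W.fileProb n)

/-- `μ` is the asymptotic miss probability of Strategy 1 with normalized cache size `β`: it is the
limit of the miss probabilities for all integer cache sizes `C n` with `C n / n → β`. -/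
def IsAsymptoticMiss1 (W : Workload) (β μ : ℝ) : Prop :=
  ∀ C : ℕ → ℕ, Tendsto (fun n => (C n : ℝ) / n) atTop (𝓝 β) →
    Tendsto (fun n => W.missStrategy1 n (C n)) atTop (𝓝 μ)

/-- `μ` is the asymptotic miss probability of Strategy 3 with normalized slice sizes `s k`. -/
def IsAsymptoticMiss3 (W : Workload) (s : Fin 3 → ℝ) (μ : ℝ) : Prop :=
  ∀ c : ℕ → Fin 3 → ℕ, (∀ k, Tendsto (fun n => (c n k : ℝ) / n) atTop (𝓝 (s k))) →
    Tendsto (fun n => W.missStrategy3 n (c n)) atTop (𝓝 μ)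

end Workload

end

/-! An LRU slice of size `C` holds the `C` most recently requested distinct files of its set. So a
request misses, roughly, when its file is absent from the last `k` requests, where `k` is the window
length at which the expected number of distinct files of the slice reaches `C`. The number of
distinct files in a window has variance at most the number of files, which is O(n); by Chebyshev its
fluctuations are negligible on the scale n. This gives the two bounds `sliceMiss_le` and
`le_sliceMiss`.

Let G_k be the subprobability distribution function of all requests to S_k. For windows of length
τn, the expected number of distinct files of S_k divided by n, and the probability that a request is
for a file of S_k absent from the window, are integrals of step functions. They converge to g_k(τ) =
b_k ∫ (1 - exp(-τ G_k'/b_k)) and m_k(τ) = ∫ G_k' exp(-τ G_k'/b_k) (`tendsto_seenLimit`,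
`tendsto_missLimit`). Hence a slice of normalized size s has limiting miss probability
m_k(g_k⁻¹(s)), or 0 when s lies beyond the range of g_k; this is `missCurve`. Convergence for both
strategies is `tendsto_missProb`.

A single cache has one window for all files, so its curves are g = Σ g_k and m = Σ m_k. If g(τ) = β,
the slice sizes s_k = g_k(τ) have total β and give the miss probability Σ m_k(τ) = m(τ) of the
single cache, so the optimal split is no worse. If β lies beyond the range of g, the same sizes are
feasible for every τ and m(τ) → 0. The minimum is attained because `missCurve` is lower
semicontinuous and the feasible set is compact. -/

noncomputable section

/-! ### The LRU cache remembers the most recent distinct requests -/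

theorem cacheAfter_concat {ι P : Type*} [DecidableEq ι] [DecidableEq P] (part : ι → P)
    (C : P → ℕ) (l : List ι) (x : ι) :
    cacheAfter part C (l ++ [x]) = cacheStep part C (cacheAfter part C l) x := by
  simp [cacheAfter]

/-- The distinct files of the slice `q` among the requests `l`. -/
def seen {ι P : Type*} [DecidableEq ι] [DecidableEq P] (part : ι → P) (q : P) (l : List ι) :
    Finset ι := l.toFinset.filter (fun x => part x = q)

theorem mem_seen {ι P : Type*} [DecidableEq ι] [DecidableEq P] {part : ι → P} {q : P}
    {l : List ι} {x : ι} : x ∈ seen part q l ↔ x ∈ l ∧ part x = q := by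
  simp [seen]

theorem seen_concat_of_eq {ι P : Type*} [DecidableEq ι] [DecidableEq P] (part : ι → P)
    (l : List ι) (x : ι) : seen part (part x) (l ++ [x]) = insert x (seen part (part x) l) := by
  ext y; simp only [mem_seen, List.mem_append, List.mem_singleton, Finset.mem_insert]
  constructor
  · rintro ⟨h | h, h'⟩
    · exact Or.inr ⟨h, h'⟩
    · exact Or.inl h
  · rintro (rfl | ⟨h, h'⟩)
    · exact ⟨Or.inr rfl, rfl⟩
    · exact ⟨Or.inl h, h'⟩

theorem seen_concat_of_ne {ι P : Type*} [DecidableEq ι] [DecidableEq P] (part : ι → P)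
    (l : List ι) {x : ι} {q : P} (h : q ≠ part x) : seen part q (l ++ [x]) = seen part q l := by
  ext y; simp only [mem_seen, List.mem_append, List.mem_singleton]
  constructor
  · rintro ⟨h1 | rfl, h'⟩
    · exact ⟨h1, h'⟩
    · exact absurd h'.symm h
  · rintro ⟨h, h'⟩
    exact ⟨Or.inl h, h'⟩

/-- The length formula says that eviction starts only once the slice is full. -/
theorem cacheAfter_spec {ι P : Type*} [DecidableEq ι] [DecidableEq P] (part : ι → P)
    (C : P → ℕ) (l : List ι) : ∀ q, (∀ x ∈ cacheAfter part C l q, x ∈ seen part q l) ∧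
      (cacheAfter part C l q).Nodup ∧
      (cacheAfter part C l q).length = min (C q) (seen part q l).card := by
  induction l using List.reverseRecOn with
  | nil => intro q; simp [cacheAfter, seen]
  | append_singleton l x ih =>
    intro q
    rw [cacheAfter_concat]
    by_cases hq : q = part x
    · subst hq
      obtain ⟨h1, h2, h3⟩ := ih (part x)
      rw [seen_concat_of_eq]
      simp only [cacheStep, Function.update_self, lruStep]
      set c := cacheAfter part C l (part x) with hc
      refine ⟨fun y hy => ?_, ?_, ?_⟩
      · rcases List.mem_cons.1 (List.mem_of_mem_take hy) with rfl | hy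
        · exact Finset.mem_insert_self _ _
        · exact Finset.mem_insert_of_mem (h1 y (List.mem_of_mem_erase hy))
      · refine List.Nodup.sublist (List.take_sublist _ _) ?_
        exact List.nodup_cons.2 ⟨h2.not_mem_erase, h2.erase x⟩
      · rw [List.length_take, List.length_cons]
        by_cases hx : x ∈ c
        · rw [List.length_erase_of_mem hx, Finset.insert_eq_of_mem (h1 x hx)]
          have := List.length_pos_of_mem hx
          omega
        · rw [List.erase_of_not_mem hx]
          by_cases hs : x ∈ seen part (part x) l
          · rw [Finset.insert_eq_of_mem hs]
            -- A file that was seen but is no longer cached has been evicted, so the slice is full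
            -- and its length stays `C`.
            have hlt : c.toFinset.card < (seen part (part x) l).card := by
              refine Finset.card_lt_card ⟨fun y hy => h1 y (List.mem_toFinset.1 hy), fun h => ?_⟩
              exact hx (List.mem_toFinset.1 (h hs))
            rw [List.toFinset_card_of_nodup h2] at hlt
            omega
          · rw [Finset.card_insert_of_notMem hs]
            omega
    · rw [seen_concat_of_ne part l hq]
      simpa [cacheStep, hq] using ih q

/-- The requests before a window only influence the tail of the cache. This reduces the steady state
to a window of recent requests. -/
theorem cacheAfter_prefix_append {ι P : Type*} [DecidableEq ι] [DecidableEq P] (part : ι → P)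
    (C : P → ℕ) (l₁ l₂ : List ι) (q : P) :
    cacheAfter part C l₂ q <+: cacheAfter part C (l₁ ++ l₂) q := by
  unfold cacheAfter
  rw [List.foldl_append]
  exact foldl_cacheStep_prefix part C l₂ _ _ (fun q => List.nil_prefix) q

/-- A window with at most `C q` distinct files of the slice evicts none of them. -/
theorem mem_cacheAfter_append {ι P : Type*} [DecidableEq ι] [DecidableEq P] {part : ι → P}
    {C : P → ℕ} {l₁ l₂ : List ι} {q : P} (h : (seen part q l₂).card ≤ C q) {x : ι}
    (hx : x ∈ l₂) (hq : part x = q) : x ∈ cacheAfter part C (l₁ ++ l₂) q := by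
  refine (cacheAfter_prefix_append part C l₁ l₂ q).subset ?_
  obtain ⟨h1, h2, h3⟩ := cacheAfter_spec part C l₂ q
  have : (cacheAfter part C l₂ q).toFinset = seen part q l₂ := by
    refine Finset.eq_of_subset_of_card_le (fun y hy => h1 y (List.mem_toFinset.1 hy)) ?_
    rw [List.toFinset_card_of_nodup h2, h3]; omega
  rw [← List.mem_toFinset, this]
  exact mem_seen.2 ⟨hx, hq⟩

/-- A window with at least `C q` distinct files of the slice fills it by itself, so nothing older
survives. -/
theorem mem_of_mem_cacheAfter_append {ι P : Type*} [DecidableEq ι] [DecidableEq P] {part : ι → P}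
    {C : P → ℕ} {l₁ l₂ : List ι} {q : P} (h : C q ≤ (seen part q l₂).card) {x : ι}
    (hx : x ∈ cacheAfter part C (l₁ ++ l₂) q) : x ∈ l₂ := by
  obtain ⟨h1, -, h3⟩ := cacheAfter_spec part C l₂ q
  have h4 := (cacheAfter_spec part C (l₁ ++ l₂) q).2.2
  have := (cacheAfter_prefix_append part C l₁ l₂ q).eq_of_length_le (by rw [h3, h4]; omega)
  rw [← this] at hx
  exact (mem_seen.1 (h1 x hx)).1

/-! ### Expectations over finitely many independent requests -/

/-- The expectation of `f` over lists of `N` independent requests with law `p`. -/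
def expect {ι : Type*} [Fintype ι] (p : ι → ℝ) (N : ℕ) (f : List ι → ℝ) : ℝ :=
  ∑ ω : Fin N → ι, (∏ j, p (ω j)) * f (List.ofFn ω)

section expect

variable {ι : Type*} [Fintype ι] {p : ι → ℝ}

theorem expect_zero (f : List ι → ℝ) : expect p 0 f = f [] := by
  simp [expect]

theorem expect_succ (N : ℕ) (f : List ι → ℝ) :
    expect p (N + 1) f = ∑ y, p y * expect p N (fun l => f (y :: l)) := by
  unfold expect
  rw [← (Fin.consEquiv (fun _ : Fin (N + 1) => ι)).sum_comp, Fintype.sum_prod_type]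
  refine Finset.sum_congr rfl fun y _ => ?_
  rw [Finset.mul_sum]
  refine Finset.sum_congr rfl fun ω _ => ?_
  have e : (Fin.consEquiv (fun _ : Fin (N + 1) => ι)) (y, ω) = Fin.cons y ω := rfl
  rw [e, Fin.prod_univ_succ, List.ofFn_succ]
  simp only [Fin.cons_zero, Fin.cons_succ]
  ring

theorem expect_const (h1 : ∑ x, p x = 1) (N : ℕ) (c : ℝ) : expect p N (fun _ => c) = c := by
  induction N with
  | zero => simp [expect_zero]
  | succ N ih => rw [expect_succ]; simp only [ih]; rw [← Finset.sum_mul, h1, one_mul]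

theorem expect_add (N : ℕ) (f g : List ι → ℝ) :
    expect p N (fun l => f l + g l) = expect p N f + expect p N g := by
  simp [expect, mul_add, Finset.sum_add_distrib]

theorem expect_const_mul (N : ℕ) (c : ℝ) (f : List ι → ℝ) :
    expect p N (fun l => c * f l) = c * expect p N f := by
  simp only [expect, Finset.mul_sum]
  exact Finset.sum_congr rfl fun _ _ => by ring

theorem expect_sum {κ : Type*} (s : Finset κ) (N : ℕ) (f : κ → List ι → ℝ) :
    expect p N (fun l => ∑ i ∈ s, f i l) = ∑ i ∈ s, expect p N (f i) := by
  simp only [expect, Finset.mul_sum]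
  exact Finset.sum_comm

theorem expect_mono (hp : ∀ x, 0 ≤ p x) (N : ℕ) {f g : List ι → ℝ}
    (h : ∀ l, l.length = N → f l ≤ g l) : expect p N f ≤ expect p N g :=
  Finset.sum_le_sum fun _ _ => mul_le_mul_of_nonneg_left (h _ (by simp))
    (Finset.prod_nonneg fun _ _ => hp _)

/-- The last `k` of `j + k` independent requests have the law of `k` requests. -/
theorem expect_drop (h1 : ∑ x, p x = 1) (j k : ℕ) (f : List ι → ℝ) :
    expect p (j + k) (fun l => f (l.drop j)) = expect p k f := by
  induction j with
  | zero => simp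
  | succ j ih =>
    rw [show j + 1 + k = j + k + 1 by ring, expect_succ]
    simp only [List.drop_succ_cons, ih]
    rw [← Finset.sum_mul, h1, one_mul]

theorem expect_forall_notMem [DecidableEq ι] (h1 : ∑ x, p x = 1) (S : Finset ι) (k : ℕ) :
    expect p k (fun l => if ∀ x ∈ S, x ∉ l then 1 else 0) = (1 - ∑ x ∈ S, p x) ^ k := by
  induction k with
  | zero => simp [expect_zero]
  | succ k ih =>
    rw [expect_succ, ← Finset.sum_add_sum_compl S]
    have e1 : ∀ y ∈ S, p y * expect p k
        (fun l => if ∀ x ∈ S, x ∉ y :: l then (1 : ℝ) else 0) = 0 := by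
      intro y hy
      have : ∀ l : List ι, ¬ ∀ x ∈ S, x ∉ y :: l := fun l h => h y hy (by simp)
      simp only [this, if_false, expect_const h1, mul_zero]
    have e2 : ∀ y ∈ Sᶜ, p y * expect p k
        (fun l => if ∀ x ∈ S, x ∉ y :: l then (1 : ℝ) else 0) =
        p y * (1 - ∑ x ∈ S, p x) ^ k := by
      intro y hy
      rw [← ih]
      congr 2
      funext l
      refine if_congr ?_ rfl rfl
      refine forall₂_congr fun x hx => ?_
      have : x ≠ y := fun h => (Finset.mem_compl.1 hy) (h ▸ hx)
      simp [this]
    rw [Finset.sum_eq_zero e1, Finset.sum_congr rfl e2, ← Finset.sum_mul, pow_succ, zero_add,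
      ← h1, ← Finset.sum_add_sum_compl S p]
    ring

theorem expect_notMem [DecidableEq ι] (h1 : ∑ x, p x = 1) (x : ι) (k : ℕ) :
    expect p k (fun l => if x ∉ l then 1 else 0) = (1 - p x) ^ k := by
  simpa using expect_forall_notMem h1 {x} k

/-- Absences of two different files are negatively correlated, because 1 - p - q ≤ (1 - p)(1 - q).
-/
theorem expect_notMem_mul_notMem_le [DecidableEq ι] (hp : ∀ x, 0 ≤ p x) (h1 : ∑ x, p x = 1)
    {x y : ι} (hxy : x ≠ y) (k : ℕ) :
    expect p k (fun l => (if x ∉ l then 1 else 0) * (if y ∉ l then 1 else 0)) ≤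
      (1 - p x) ^ k * (1 - p y) ^ k := by
  have h := expect_forall_notMem h1 {x, y} k
  have hle : p x + p y ≤ 1 := by
    rw [← h1, ← Finset.sum_pair hxy]
    exact Finset.sum_le_sum_of_subset_of_nonneg (Finset.subset_univ _) fun i _ _ => hp i
  rw [Finset.sum_pair hxy] at h
  have e : (fun l : List ι => (if x ∉ l then (1 : ℝ) else 0) * (if y ∉ l then 1 else 0)) =
      fun l => if ∀ z ∈ ({x, y} : Finset ι), z ∉ l then 1 else 0 := by
    funext l
    by_cases hx : x ∈ l <;> by_cases hy : y ∈ l <;> simp [hx, hy]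
  rw [e, h, ← mul_pow]
  refine pow_le_pow_left₀ (by linarith) ?_ k
  nlinarith [mul_nonneg (hp x) (hp y)]

theorem prob_le_one (hp : ∀ x, 0 ≤ p x) (h1 : ∑ x, p x = 1) (x : ι) : p x ≤ 1 := by
  rw [← h1]; exact Finset.single_le_sum (fun i _ => hp i) (Finset.mem_univ x)

/-- The number of files of `A` that are not requested has variance at most `#A`. -/
theorem expect_sq_unseen_le [DecidableEq ι] (hp : ∀ x, 0 ≤ p x) (h1 : ∑ x, p x = 1)
    (A : Finset ι) (k : ℕ) :
    expect p k (fun l => (∑ x ∈ A, ((if x ∉ l then 1 else 0) - (1 - p x) ^ k)) ^ 2) ≤ A.card := by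
  have hb : ∀ x, 0 ≤ (1 - p x) ^ k ∧ (1 - p x) ^ k ≤ 1 := fun x =>
    ⟨pow_nonneg (by linarith [prob_le_one hp h1 x]) k,
      pow_le_one₀ (by linarith [prob_le_one hp h1 x]) (by linarith [hp x])⟩
  simp only [sq, Finset.sum_mul_sum]
  rw [expect_sum]
  -- The variance is bounded entry by entry: diagonal covariances are at most 1, the others at most
  -- 0.
  have : (A.card : ℝ) = ∑ x ∈ A, ∑ y ∈ A, if x = y then (1 : ℝ) else 0 := by
    simp
  rw [this]
  refine Finset.sum_le_sum fun x _ => ?_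
  rw [expect_sum]
  refine Finset.sum_le_sum fun y _ => ?_
  have expand : expect p k (fun l => ((if x ∉ l then 1 else 0) - (1 - p x) ^ k) *
      ((if y ∉ l then 1 else 0) - (1 - p y) ^ k)) =
      expect p k (fun l => (if x ∉ l then 1 else 0) * (if y ∉ l then 1 else 0)) -
        (1 - p x) ^ k * (1 - p y) ^ k := by
    have e : (fun l : List ι => ((if x ∉ l then (1 : ℝ) else 0) - (1 - p x) ^ k) *
        ((if y ∉ l then 1 else 0) - (1 - p y) ^ k)) = fun l =>
        (if x ∉ l then (1 : ℝ) else 0) * (if y ∉ l then 1 else 0) +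
        ((-(1 - p y) ^ k) * (if x ∉ l then 1 else 0) +
          ((-(1 - p x) ^ k) * (if y ∉ l then 1 else 0) + (1 - p x) ^ k * (1 - p y) ^ k)) := by
      funext l; ring
    rw [e, expect_add, expect_add, expect_add, expect_const_mul, expect_const_mul,
      expect_const h1, expect_notMem h1, expect_notMem h1]
    ring
  rw [expand]
  split_ifs with hxy
  · subst hxy
    have : (fun l : List ι => (if x ∉ l then (1 : ℝ) else 0) * (if x ∉ l then 1 else 0)) =
        fun l => if x ∉ l then 1 else 0 := by
      funext l; split_ifs <;> simp
    rw [this, expect_notMem h1]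
    nlinarith [hb x]
  · linarith [expect_notMem_mul_notMem_le hp h1 hxy k]

end expect

/-! ### Miss probabilities of one slice -/

section slice

variable {ι P : Type*} [Fintype ι] [DecidableEq P]

/-- The files of the slice `q`. -/
def slice (part : ι → P) (q : P) : Finset ι := Finset.univ.filter fun x => part x = q

theorem sum_slice_mul_le {p : ι → ℝ} (hp : ∀ x, 0 ≤ p x) (h1 : ∑ x, p x = 1) (part : ι → P)
    (q : P) {c : ℝ} (hc : 0 ≤ c) : ∑ x ∈ slice part q, p x * c ≤ c := by
  rw [← Finset.sum_mul]
  refine mul_le_of_le_one_left hc ?_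
  rw [← h1]
  exact Finset.sum_le_sum_of_subset_of_nonneg (Finset.subset_univ _) fun i _ _ => hp i

variable [DecidableEq ι]

/-- The probability that the request after `N` others is a miss in the slice `q`. -/
def sliceMiss (part : ι → P) (C : P → ℕ) (p : ι → ℝ) (q : P) (N : ℕ) : ℝ :=
  ∑ x ∈ slice part q, p x * expect p N (fun l => if x ∈ cacheAfter part C l q then 0 else 1)

theorem missAt_eq_sum_sliceMiss [Fintype P] (part : ι → P) (C : P → ℕ) (p : ι → ℝ) (N : ℕ) :
    missAt part C p N = ∑ q, sliceMiss part C p q N := by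
  unfold missAt sliceMiss slice
  rw [Finset.sum_comm, ← Finset.sum_fiberwise Finset.univ part]
  refine Finset.sum_congr rfl fun q _ => Finset.sum_congr rfl fun x hx => ?_
  rw [(Finset.mem_filter.1 hx).2, expect, Finset.mul_sum]
  exact Finset.sum_congr rfl fun _ _ => by ring

/-- The expected number of distinct files of the slice `q` among `k` requests. -/
def meanSeen (part : ι → P) (p : ι → ℝ) (q : P) (k : ℕ) : ℝ :=
  ∑ x ∈ slice part q, (1 - (1 - p x) ^ k)

/-- The probability that a request is for a file of the slice `q` that is not among the preceding
`k` requests. -/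
def missRecent (part : ι → P) (p : ι → ℝ) (q : P) (k : ℕ) : ℝ :=
  ∑ x ∈ slice part q, p x * (1 - p x) ^ k

theorem card_seen_sub_meanSeen (part : ι → P) (p : ι → ℝ) (q : P) (k : ℕ) (l : List ι) :
    ((seen part q l).card : ℝ) - meanSeen part p q k =
      - ∑ x ∈ slice part q, ((if x ∉ l then 1 else 0) - (1 - p x) ^ k) := by
  have : ((seen part q l).card : ℝ) = ∑ x ∈ slice part q, if x ∈ l then (1 : ℝ) else 0 := by
    rw [Finset.sum_boole]
    congr 2
    ext x
    simp [mem_seen, slice, and_comm]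
  rw [this, meanSeen, ← Finset.sum_sub_distrib, ← Finset.sum_neg_distrib]
  refine Finset.sum_congr rfl fun x _ => ?_
  by_cases hx : x ∈ l <;> simp [hx]

/-- Chebyshev's inequality with the variance bound `expect_sq_unseen_le`. -/
theorem expect_deviation_le {p : ι → ℝ} (hp : ∀ x, 0 ≤ p x) (h1 : ∑ x, p x = 1) (part : ι → P)
    (q : P) (k : ℕ) {δ : ℝ} (hδ : 0 < δ) :
    expect p k (fun l => if δ ≤ |((seen part q l).card : ℝ) - meanSeen part p q k| then 1 else 0)
      ≤ (slice part q).card / δ ^ 2 := by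
  have hδ2 : 0 < δ ^ 2 := by positivity
  rw [le_div_iff₀ hδ2, mul_comm, ← expect_const_mul]
  refine le_trans (expect_mono hp k fun l _ => ?_) (expect_sq_unseen_le hp h1 (slice part q) k)
  rw [card_seen_sub_meanSeen, abs_neg]
  split_ifs with h
  · rw [mul_one, ← sq_abs (∑ x ∈ slice part q, _)]
    exact pow_le_pow_left₀ hδ.le h 2
  · rw [mul_zero]; positivity

theorem sum_slice_mul_expect_drop {p : ι → ℝ} (h1 : ∑ x, p x = 1) (part : ι → P) (q : P)
    (j k : ℕ) : ∑ x ∈ slice part q, p x *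
      expect p (j + k) (fun l => if x ∉ l.drop j then 1 else 0) = missRecent part p q k := by
  refine Finset.sum_congr rfl fun x _ => ?_
  rw [expect_drop h1 j k (fun l => if x ∉ l then 1 else 0), expect_notMem h1]

/-- Unless the last `k` requests contain more than `C q` files of the slice, a miss must be for a
file outside that window. The exceptional event has deviation at least `δ`. The bound does not
depend on `N`. -/
theorem sliceMiss_le {p : ι → ℝ} (hp : ∀ x, 0 ≤ p x) (h1 : ∑ x, p x = 1) (part : ι → P)
    (C : P → ℕ) (q : P) {k N : ℕ} (hN : k ≤ N) {δ : ℝ} (hδ : 0 < δ)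
    (hC : meanSeen part p q k + δ ≤ C q) :
    sliceMiss part C p q N ≤ missRecent part p q k + (slice part q).card / δ ^ 2 := by
  obtain ⟨j, rfl⟩ := Nat.exists_eq_add_of_le' hN
  have hdev := expect_deviation_le hp h1 part q k hδ
  rw [← expect_drop h1 j k] at hdev
  refine le_trans ?_ (add_le_add (sum_slice_mul_expect_drop h1 part q j k).le
    (sum_slice_mul_le hp h1 part q (by positivity)))
  rw [← Finset.sum_add_distrib]
  refine Finset.sum_le_sum fun x hx => ?_
  rw [← mul_add]
  refine mul_le_mul_of_nonneg_left ?_ (hp x)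
  refine le_trans ?_ (add_le_add le_rfl hdev)
  rw [← expect_add]
  refine expect_mono hp _ fun l _ => ?_
  by_cases hd : C q < (seen part q (l.drop j)).card
  · have : (C q : ℝ) < (seen part q (l.drop j)).card := by exact_mod_cast hd
    rw [if_pos (c := δ ≤ _) (le_trans (by linarith) (le_abs_self _))]
    split_ifs <;> norm_num
  · by_cases hxl : x ∈ l.drop j
    · have := mem_cacheAfter_append (l₁ := l.take j) (not_lt.1 hd) hxl (Finset.mem_filter.1 hx).2
      rw [List.take_append_drop] at this
      rw [if_pos this]
      split_ifs <;> norm_num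
    · rw [if_pos hxl]
      split_ifs <;> norm_num

/-- Mirror image of `sliceMiss_le`: unless the window contains fewer than `C q` files of the slice,
every file outside it has been evicted. -/
theorem le_sliceMiss {p : ι → ℝ} (hp : ∀ x, 0 ≤ p x) (h1 : ∑ x, p x = 1) (part : ι → P)
    (C : P → ℕ) (q : P) {k N : ℕ} (hN : k ≤ N) {δ : ℝ} (hδ : 0 < δ)
    (hC : C q + δ ≤ meanSeen part p q k) :
    missRecent part p q k ≤ sliceMiss part C p q N + (slice part q).card / δ ^ 2 := by
  obtain ⟨j, rfl⟩ := Nat.exists_eq_add_of_le' hN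
  have hdev := expect_deviation_le hp h1 part q k hδ
  rw [← expect_drop h1 j k] at hdev
  refine le_trans ?_ (add_le_add le_rfl
    (sum_slice_mul_le hp h1 part q (by positivity)))
  rw [← sum_slice_mul_expect_drop h1 part q j k, sliceMiss, ← Finset.sum_add_distrib]
  refine Finset.sum_le_sum fun x hx => ?_
  rw [← mul_add]
  refine mul_le_mul_of_nonneg_left ?_ (hp x)
  refine le_trans ?_ (add_le_add le_rfl hdev)
  rw [← expect_add]
  refine expect_mono hp _ fun l _ => ?_
  by_cases hd : (seen part q (l.drop j)).card < C q
  · have : ((seen part q (l.drop j)).card : ℝ) < C q := by exact_mod_cast hd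
    rw [if_pos (c := δ ≤ _) (le_trans (by linarith) (neg_le_abs _))]
    split_ifs <;> norm_num
  · by_cases hxl : x ∈ l.drop j
    · rw [if_neg (not_not.2 hxl)]
      split_ifs <;> norm_num
    · have : x ∉ cacheAfter part C l q := fun h => hxl <| by
        rw [← List.take_append_drop j l] at h
        exact mem_of_mem_cacheAfter_append (not_lt.1 hd) h
      rw [if_neg this]
      split_ifs <;> norm_num

theorem sliceMiss_nonneg {p : ι → ℝ} (hp : ∀ x, 0 ≤ p x) (h1 : ∑ x, p x = 1) (part : ι → P)
    (C : P → ℕ) (q : P) (N : ℕ) : 0 ≤ sliceMiss part C p q N := by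
  refine Finset.sum_nonneg fun x _ => mul_nonneg (hp x) ?_
  refine (expect_const h1 N 0).symm.le.trans ?_
  exact expect_mono hp N fun l _ => by split_ifs <;> norm_num

/-- Needed for normalized size 0, where no window leaves the room `δ` required by `sliceMiss_le`. -/
theorem sliceMiss_le_missRecent_zero {p : ι → ℝ} (hp : ∀ x, 0 ≤ p x) (h1 : ∑ x, p x = 1)
    (part : ι → P) (C : P → ℕ) (q : P) (N : ℕ) :
    sliceMiss part C p q N ≤ missRecent part p q 0 := by
  refine Finset.sum_le_sum fun x _ => mul_le_mul_of_nonneg_left ?_ (hp x)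
  rw [pow_zero]
  refine le_trans ?_ (expect_const h1 N 1).le
  exact expect_mono hp N fun l _ => by split_ifs <;> norm_num

end slice

/-! ### Miss probability as a function of the normalized cache size -/

/-- `g τ` is the normalized number of distinct files requested in a window of normalized length
`τ`, and `m τ` the probability that a request is for a file that is not requested in the preceding
window. -/
structure IsMissCurve (g m : ℝ → ℝ) : Prop where
  map_zero : g 0 = 0
  strictMonoOn : StrictMonoOn g (Set.Ici 0)
  continuousOn_seen : ContinuousOn g (Set.Ici 0)
  continuousOn_miss : ContinuousOn m (Set.Ici 0)
  antitoneOn : AntitoneOn m (Set.Ici 0)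
  nonneg : ∀ τ, 0 ≤ τ → 0 ≤ m τ
  tendsto_atTop : Tendsto m atTop (𝓝 0)

/-- The asymptotic miss probability as a function of the normalized cache size. -/
def missCurve (g m : ℝ → ℝ) (s : ℝ) : ℝ :=
  ⨆ τ : {τ : ℝ // 0 ≤ τ}, if s < g τ then m τ else 0

namespace IsMissCurve

variable {g m : ℝ → ℝ}

theorem sum {κ : Type*} [Fintype κ] [Nonempty κ] {g m : κ → ℝ → ℝ}
    (h : ∀ k, IsMissCurve (g k) (m k)) :
    IsMissCurve (fun τ => ∑ k, g k τ) (fun τ => ∑ k, m k τ) where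
  map_zero := Finset.sum_eq_zero fun k _ => (h k).map_zero
  strictMonoOn := fun _ hx _ hy hxy =>
    Finset.sum_lt_sum_of_nonempty Finset.univ_nonempty fun k _ => (h k).strictMonoOn hx hy hxy
  continuousOn_seen := continuousOn_finsetSum _ fun k _ => (h k).continuousOn_seen
  continuousOn_miss := continuousOn_finsetSum _ fun k _ => (h k).continuousOn_miss
  antitoneOn := fun _ hx _ hy hxy => Finset.sum_le_sum fun k _ => (h k).antitoneOn hx hy hxy
  nonneg := fun τ hτ => Finset.sum_nonneg fun k _ => (h k).nonneg τ hτ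
  tendsto_atTop := by
    simpa using tendsto_finsetSum Finset.univ fun k _ => (h k).tendsto_atTop

theorem bddAbove (h : IsMissCurve g m) (s : ℝ) :
    BddAbove (Set.range fun τ : {τ : ℝ // 0 ≤ τ} => if s < g τ then m τ else 0) := by
  refine ⟨m 0, ?_⟩
  rintro _ ⟨⟨τ, hτ⟩, rfl⟩
  dsimp only
  split_ifs
  · exact h.antitoneOn (Set.mem_Ici.2 le_rfl) (Set.mem_Ici.2 hτ) hτ
  · exact h.nonneg 0 le_rfl

theorem missCurve_nonneg (h : IsMissCurve g m) (s : ℝ) : 0 ≤ missCurve g m s :=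
  Real.iSup_nonneg fun τ => by
    split_ifs
    · exact h.nonneg _ τ.2
    · exact le_rfl

theorem le_missCurve_of_lt (h : IsMissCurve g m) {s τ : ℝ} (hτ : 0 ≤ τ) (hs : s < g τ) :
    m τ ≤ missCurve g m s := by
  have := le_ciSup (h.bddAbove s) ⟨τ, hτ⟩
  rwa [if_pos hs] at this

/-- On the range of `g` the supremum is m ∘ g⁻¹: `m` is antitone, so windows slightly longer than
`τ` approach the value `m τ`. Beyond the range every term is 0. -/
theorem missCurve_apply (h : IsMissCurve g m) {τ : ℝ} (hτ : 0 ≤ τ) :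
    missCurve g m (g τ) = m τ := by
  refine le_antisymm ?_ ?_
  · have : Nonempty {τ : ℝ // 0 ≤ τ} := ⟨⟨0, le_rfl⟩⟩
    refine ciSup_le fun σ => ?_
    split_ifs with hlt
    · exact h.antitoneOn hτ σ.2 ((h.strictMonoOn.lt_iff_lt hτ σ.2).1 hlt).le
    · exact h.nonneg τ hτ
  · have hc : Tendsto m (𝓝[>] τ) (𝓝 (m τ)) :=
      (h.continuousOn_miss τ hτ).mono fun x hx => le_trans hτ (le_of_lt hx)
    refine le_of_tendsto hc ?_
    filter_upwards [self_mem_nhdsWithin] with σ hσ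
    have hσ0 : 0 ≤ σ := hτ.trans (le_of_lt hσ)
    exact h.le_missCurve_of_lt hσ0 (h.strictMonoOn hτ hσ0 hσ)

/-- In the second case the cache is never filled by a window of finite normalized length. -/
theorem exists_eq_or_forall_lt (h : IsMissCurve g m) {s : ℝ} (hs : 0 ≤ s) :
    (∃ τ, 0 ≤ τ ∧ g τ = s) ∨ ∀ τ, 0 ≤ τ → g τ < s := by
  by_cases hall : ∀ τ, 0 ≤ τ → g τ < s
  · exact Or.inr hall
  · push Not at hall
    obtain ⟨τ, hτ, hle⟩ := hall
    obtain ⟨σ, hσ, e⟩ := intermediate_value_Icc hτ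
      (h.continuousOn_seen.mono Set.Icc_subset_Ici_self) (show s ∈ Set.Icc (g 0) (g τ) from
        ⟨h.map_zero.trans_le hs, hle⟩)
    exact Or.inl ⟨σ, hσ.1, e⟩

/-- The strict inequality `g τ < s` leaves room for fluctuations of order n in `sliceMiss_le`. It is
obtained by shortening the critical window, which is impossible if that window has length 0; hence
the first alternative. -/
theorem exists_upper (h : IsMissCurve g m) {s ε : ℝ} (hs : 0 ≤ s) (hε : 0 < ε) :
    m 0 ≤ missCurve g m s ∨ ∃ τ, 0 ≤ τ ∧ g τ < s ∧ m τ < missCurve g m s + ε := by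
  rcases h.exists_eq_or_forall_lt hs with ⟨τ, hτ, rfl⟩ | hlt
  · rw [h.missCurve_apply hτ]
    rcases hτ.eq_or_lt with rfl | hpos
    · exact Or.inl le_rfl
    · right
      have hc : ContinuousAt m τ := (h.continuousOn_miss τ hτ).continuousAt (Ici_mem_nhds hpos)
      have h1 : ∀ᶠ σ in 𝓝[<] τ, m σ < m τ + ε :=
        (hc.tendsto.mono_left nhdsWithin_le_nhds).eventually_lt_const (by linarith)
      have h2 : ∀ᶠ σ in 𝓝[<] τ, 0 ≤ σ := by
        filter_upwards [nhdsWithin_le_nhds (Ici_mem_nhds hpos)] with σ hσ using hσ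
      obtain ⟨σ, ⟨hσ1, hσ2⟩, hσ3⟩ := ((h1.and h2).and self_mem_nhdsWithin).exists
      exact ⟨σ, hσ2, h.strictMonoOn hσ2 hτ hσ3, hσ1⟩
  · right
    have h1 := h.tendsto_atTop.eventually_lt_const
      (show 0 < missCurve g m s + ε by linarith [h.missCurve_nonneg s])
    obtain ⟨τ, hτ1, hτ2⟩ := (h1.and (eventually_ge_atTop 0)).exists
    exact ⟨τ, hτ2, hlt τ hτ2, hτ1⟩

theorem exists_lower (s : ℝ) {ε : ℝ} (hε : 0 < ε) :
    missCurve g m s ≤ ε ∨ ∃ τ, 0 ≤ τ ∧ s < g τ ∧ missCurve g m s - ε < m τ := by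
  by_cases hle : missCurve g m s ≤ ε
  · exact Or.inl hle
  · right
    have : Nonempty {τ : ℝ // 0 ≤ τ} := ⟨⟨0, le_rfl⟩⟩
    obtain ⟨τ, hτ⟩ := exists_lt_of_lt_ciSup
      (show missCurve g m s - ε < ⨆ τ : {τ : ℝ // 0 ≤ τ}, if s < g τ then m τ else 0 from
        sub_lt_self _ hε)
    split_ifs at hτ with hs
    · exact ⟨τ, τ.2, hs, hτ⟩
    · linarith

/-- Each term of the supremum is a nonnegative constant on an open half-line and 0 elsewhere, hence
lower semicontinuous. -/
theorem lowerSemicontinuous_missCurve (h : IsMissCurve g m) :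
    LowerSemicontinuous (missCurve g m) := by
  refine lowerSemicontinuous_ciSup h.bddAbove fun τ => ?_
  intro s c hc
  by_cases hs : s < g τ
  · filter_upwards [eventually_lt_nhds hs] with t ht
    simpa [hs, ht] using hc
  · simp only [hs, if_false] at hc
    refine Eventually.of_forall fun t => ?_
    dsimp only
    split_ifs
    · exact hc.trans_le (h.nonneg _ τ.2)
    · exact hc

end IsMissCurve

/-! ### Convergence of miss probabilities -/

section limit

variable {ι : ℕ → Type*} {P : Type*} [∀ n, Fintype (ι n)] [∀ n, DecidableEq (ι n)]
  [DecidableEq P] {part : ∀ n, ι n → P} {C : ℕ → P → ℕ} {p : ∀ n, ι n → ℝ}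

theorem tendsto_card_div_sq {B : ℝ} {a : ℕ → ℕ} (ha : ∀ n, (a n : ℝ) ≤ B * n) {η : ℝ}
    (hη : 0 < η) : Tendsto (fun n : ℕ => (a n : ℝ) / (η * n) ^ 2) atTop (𝓝 0) := by
  have h0 : Tendsto (fun n : ℕ => B / η ^ 2 / (n : ℝ)) atTop (𝓝 0) :=
    tendsto_const_div_atTop_nhds_zero_nat _
  refine squeeze_zero' (Eventually.of_forall fun n => by positivity) ?_ h0
  filter_upwards [eventually_gt_atTop 0] with n hn
  have hn' : (0 : ℝ) < n := by exact_mod_cast hn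
  rw [div_div, div_le_div_iff₀ (by positivity) (by positivity)]
  have := mul_le_mul_of_nonneg_right (ha n) (show 0 ≤ η ^ 2 * (n : ℝ) by positivity)
  nlinarith [this]

theorem eventually_abs_sliceMiss_sub_le {g m : ℝ → ℝ} (h : IsMissCurve g m) (q : P) {s B : ℝ}
    (hs : 0 ≤ s) (hp : ∀ᶠ n in atTop, (∀ x, 0 ≤ p n x) ∧ ∑ x, p n x = 1)
    (hB : ∀ n, ((slice (part n) q).card : ℝ) ≤ B * n)
    (hg : ∀ τ : ℝ, 0 ≤ τ → Tendsto (fun n : ℕ => meanSeen (part n) (p n) q ⌊τ * n⌋₊ / n) atTop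
      (𝓝 (g τ)))
    (hm : ∀ τ : ℝ, 0 ≤ τ → Tendsto (fun n : ℕ => missRecent (part n) (p n) q ⌊τ * n⌋₊) atTop
      (𝓝 (m τ)))
    (hC : Tendsto (fun n => (C n q : ℝ) / n) atTop (𝓝 s)) {ε : ℝ} (hε : 0 < ε) :
    ∀ᶠ n in atTop, ∀ᶠ N in atTop,
      |sliceMiss (part n) (C n) (p n) q N - missCurve g m s| ≤ ε := by
  have upper : ∀ᶠ n in atTop, ∀ᶠ N in atTop,
      sliceMiss (part n) (C n) (p n) q N ≤ missCurve g m s + ε := by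
    rcases h.exists_upper hs (half_pos hε) with h0 | ⟨τ, hτ, hgs, hms⟩
    · have := (hm 0 le_rfl).eventually_lt_const (show m 0 < missCurve g m s + ε by linarith)
      filter_upwards [this, hp] with n hn ⟨hp0, hp1⟩
      refine Eventually.of_forall fun N => ?_
      refine (sliceMiss_le_missRecent_zero hp0 hp1 _ _ q N).trans ?_
      simpa using hn.le
    -- One third of the gap each for the error of the mean, the error of the capacity and the
    -- fluctuation `δ = η n`.
    · obtain ⟨η, hη, e⟩ : ∃ η : ℝ, 0 < η ∧ g τ + 3 * η = s := ⟨(s - g τ) / 3, by linarith, by ring⟩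
      have e1 := (hg τ hτ).eventually_lt_const (show g τ < g τ + η by linarith)
      have e2 := hC.eventually_const_lt (show s - η < s by linarith)
      have e3 := (hm τ hτ).eventually_lt_const hms
      have e4 := (tendsto_card_div_sq hB hη).eventually_lt_const (half_pos hε)
      filter_upwards [e1, e2, e3, e4, hp, eventually_gt_atTop 0] with n h1 h2 h3 h4 ⟨hp0, hp1⟩ hn
      have hn' : (0 : ℝ) < n := by exact_mod_cast hn
      filter_upwards [eventually_ge_atTop ⌊τ * n⌋₊] with N hN
      rw [div_lt_iff₀ hn'] at h1
      rw [lt_div_iff₀ hn'] at h2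
      have := sliceMiss_le hp0 hp1 (part n) (C n) q hN (mul_pos hη hn') (by
        have : (g τ + η) * n + η * n ≤ (s - η) * n := by rw [← e]; linarith
        linarith)
      linarith
  have lower : ∀ᶠ n in atTop, ∀ᶠ N in atTop,
      missCurve g m s - ε ≤ sliceMiss (part n) (C n) (p n) q N := by
    rcases IsMissCurve.exists_lower (g := g) (m := m) s (half_pos hε) with h0 | ⟨τ, hτ, hgs, hms⟩
    · filter_upwards [hp] with n ⟨hp0, hp1⟩
      refine Eventually.of_forall fun N => ?_
      linarith [sliceMiss_nonneg hp0 hp1 (part n) (C n) q N]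
    · obtain ⟨η, hη, e⟩ : ∃ η : ℝ, 0 < η ∧ s + 3 * η = g τ := ⟨(g τ - s) / 3, by linarith, by ring⟩
      have e1 := (hg τ hτ).eventually_const_lt (show g τ - η < g τ by linarith)
      have e2 := hC.eventually_lt_const (show s < s + η by linarith)
      have e3 := (hm τ hτ).eventually_const_lt hms
      have e4 := (tendsto_card_div_sq hB hη).eventually_lt_const (half_pos hε)
      filter_upwards [e1, e2, e3, e4, hp, eventually_gt_atTop 0] with n h1 h2 h3 h4 ⟨hp0, hp1⟩ hn
      have hn' : (0 : ℝ) < n := by exact_mod_cast hn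
      filter_upwards [eventually_ge_atTop ⌊τ * n⌋₊] with N hN
      rw [lt_div_iff₀ hn'] at h1
      rw [div_lt_iff₀ hn'] at h2
      have := le_sliceMiss hp0 hp1 (part n) (C n) q hN (mul_pos hη hn') (by
        have : (s + η) * n + η * n ≤ (g τ - η) * n := by rw [← e]; linarith
        linarith)
      linarith
  filter_upwards [upper, lower] with n h1 h2
  filter_upwards [h1, h2] with N h3 h4
  rw [abs_le]
  constructor <;> linarith

theorem tendsto_missProb [Fintype P] {g m : P → ℝ → ℝ} (h : ∀ q, IsMissCurve (g q) (m q))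
    {s : P → ℝ} {B : ℝ} (hs : ∀ q, 0 ≤ s q)
    (hp : ∀ᶠ n in atTop, (∀ x, 0 ≤ p n x) ∧ ∑ x, p n x = 1)
    (hB : ∀ n q, ((slice (part n) q).card : ℝ) ≤ B * n)
    (hg : ∀ q (τ : ℝ), 0 ≤ τ → Tendsto (fun n : ℕ => meanSeen (part n) (p n) q ⌊τ * n⌋₊ / n) atTop
      (𝓝 (g q τ)))
    (hm : ∀ q (τ : ℝ), 0 ≤ τ → Tendsto (fun n : ℕ => missRecent (part n) (p n) q ⌊τ * n⌋₊) atTop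
      (𝓝 (m q τ)))
    (hC : ∀ q, Tendsto (fun n => (C n q : ℝ) / n) atTop (𝓝 (s q))) :
    Tendsto (fun n => missProb (part n) (C n) (p n)) atTop
      (𝓝 (∑ q, missCurve (g q) (m q) (s q))) := by
  rw [Metric.tendsto_nhds]
  intro ε hε
  -- Summed over all slices this stays within `ε / 2`; the `+ 1` keeps the denominator positive.
  have hd : 0 < ε / 2 / (Fintype.card P + 1) := by positivity
  have key := eventually_all.2 fun q =>
    eventually_abs_sliceMiss_sub_le (h q) q (hs q) hp (fun n => hB n q) (hg q) (hm q) (hC q) hd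
  filter_upwards [key, hp] with n hn ⟨hp0, hp1⟩
  have hlim := ((tendsto_missAt (part n) (C n) (p n) hp0 hp1).sub_const
    (∑ q, missCurve (g q) (m q) (s q))).abs
  rw [Real.dist_eq]
  refine lt_of_le_of_lt (le_of_tendsto hlim ?_) (half_lt_self hε)
  filter_upwards [eventually_all.2 hn] with N hN
  rw [missAt_eq_sum_sliceMiss, ← Finset.sum_sub_distrib]
  refine (Finset.abs_sum_le_sum_abs _ _).trans ((Finset.sum_le_sum fun q _ => hN q).trans ?_)
  rw [Finset.sum_const, nsmul_eq_mul, Finset.card_univ, mul_div_assoc', div_le_iff₀ (by positivity)]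
  nlinarith

end limit

/-! ### Miss curves of densities -/

open MeasureTheory in
theorem isMissCurve_of_density {α : Type*} [MeasurableSpace α] {μ : Measure α} [IsFiniteMeasure μ]
    {h : α → ℝ} (hi : Integrable h μ) (h0 : ∀ᵐ x ∂μ, 0 ≤ h x) (hpos : 0 < ∫ x, h x ∂μ) {b : ℝ}
    (hb : 0 < b) :
    IsMissCurve (fun τ => b * ∫ x, (1 - Real.exp (-(τ / b * h x))) ∂μ)
      (fun τ => ∫ x, h x * Real.exp (-(τ / b * h x)) ∂μ) := by
  have meas : ∀ τ : ℝ, AEStronglyMeasurable (fun x => Real.exp (-(τ / b * h x))) μ := fun τ =>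
    Real.continuous_exp.comp_aestronglyMeasurable (hi.aestronglyMeasurable.const_mul _).neg
  have exp_le : ∀ τ : ℝ, 0 ≤ τ → ∀ y : ℝ, 0 ≤ y → Real.exp (-(τ / b * y)) ≤ 1 := fun τ hτ y hy =>
    Real.exp_le_one_iff.2 (neg_nonpos.2 (by positivity))
  have bound1 : ∀ τ : ℝ, 0 ≤ τ → ∀ᵐ x ∂μ, ‖1 - Real.exp (-(τ / b * h x))‖ ≤ 1 := by
    intro τ hτ
    filter_upwards [h0] with x hx
    rw [Real.norm_eq_abs, abs_le]
    constructor <;> linarith [exp_le τ hτ _ hx, Real.exp_pos (-(τ / b * h x))]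
  have bound2 : ∀ τ : ℝ, 0 ≤ τ → ∀ᵐ x ∂μ, ‖h x * Real.exp (-(τ / b * h x))‖ ≤ h x := by
    intro τ hτ
    filter_upwards [h0] with x hx
    rw [Real.norm_of_nonneg (mul_nonneg hx (Real.exp_pos _).le)]
    exact mul_le_of_le_one_right hx (exp_le τ hτ _ hx)
  have int1 : ∀ τ : ℝ, 0 ≤ τ → Integrable (fun x => 1 - Real.exp (-(τ / b * h x))) μ :=
    fun τ hτ => (integrable_const (1 : ℝ)).mono' (aestronglyMeasurable_const.sub (meas τ))
      (bound1 τ hτ)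
  have int2 : ∀ τ : ℝ, 0 ≤ τ → Integrable (fun x => h x * Real.exp (-(τ / b * h x))) μ :=
    fun τ hτ => hi.mono' (hi.aestronglyMeasurable.mul (meas τ)) (bound2 τ hτ)
  refine ⟨by simp, ?_, ?_, ?_, ?_, ?_, ?_⟩
  · intro τ hτ σ hσ hlt
    refine mul_lt_mul_of_pos_left ?_ hb
    have hle : ∀ᵐ x ∂μ, 0 ≤ Real.exp (-(τ / b * h x)) - Real.exp (-(σ / b * h x)) := by
      filter_upwards [h0] with x hx
      have : τ / b * h x ≤ σ / b * h x := by gcongr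
      linarith [Real.exp_le_exp.2 (neg_le_neg this)]
    have hint : Integrable (fun x => Real.exp (-(τ / b * h x)) - Real.exp (-(σ / b * h x))) μ := by
      refine ((int1 σ hσ).sub (int1 τ hτ)).congr (Eventually.of_forall fun x => ?_)
      simp
    rw [← sub_pos, ← integral_sub (int1 σ hσ) (int1 τ hτ)]
    have e : (fun x => (1 - Real.exp (-(σ / b * h x))) - (1 - Real.exp (-(τ / b * h x)))) =
        fun x => Real.exp (-(τ / b * h x)) - Real.exp (-(σ / b * h x)) := by
      funext x; ring
    rw [e]
    -- Equality would make the two exponentials agree almost everywhere, so `h` would vanish almost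
    -- everywhere.
    refine (integral_nonneg_of_ae hle).lt_of_ne fun h_eq => hpos.ne' ?_
    have hz := (integral_eq_zero_iff_of_nonneg_ae hle hint).1 h_eq.symm
    refine integral_eq_zero_of_ae ?_
    filter_upwards [hz] with x hx
    have hx' := Real.exp_injective (sub_eq_zero.1 hx)
    have : (σ - τ) / b * h x = 0 := by rw [sub_div, sub_mul]; linarith
    rcases mul_eq_zero.1 this with h' | h'
    · exact absurd h' (div_pos (sub_pos.2 hlt) hb).ne'
    · exact h'
  · refine ContinuousOn.mul continuousOn_const (continuousOn_of_dominated (bound := fun _ => 1)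
      (fun τ _ => aestronglyMeasurable_const.sub (meas τ)) bound1 (integrable_const _)
      (Eventually.of_forall fun x => ?_))
    fun_prop
  · refine continuousOn_of_dominated (bound := h)
      (fun τ _ => hi.aestronglyMeasurable.mul (meas τ)) bound2 hi
      (Eventually.of_forall fun x => ?_)
    fun_prop
  · intro τ hτ σ hσ hle
    refine integral_mono_ae (int2 σ hσ) (int2 τ hτ) ?_
    filter_upwards [h0] with x hx
    have : τ / b * h x ≤ σ / b * h x := by gcongr
    exact mul_le_mul_of_nonneg_left (Real.exp_le_exp.2 (neg_le_neg this)) hx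
  · intro τ _
    refine integral_nonneg_of_ae ?_
    filter_upwards [h0] with x hx
    exact mul_nonneg hx (Real.exp_pos _).le
  · rw [← integral_zero α ℝ (μ := μ)]
    refine tendsto_integral_filter_of_dominated_convergence h
      (Eventually.of_forall fun τ => hi.aestronglyMeasurable.mul (meas τ)) ?_ hi ?_
    · filter_upwards [eventually_ge_atTop 0] with τ hτ using bound2 τ hτ
    · filter_upwards [h0] with x hx
      rcases hx.eq_or_lt with h' | h'
      · simp [← h']
      · have : Tendsto (fun τ : ℝ => τ / b * h x) atTop atTop :=
          (tendsto_id.atTop_div_const hb).atTop_mul_const h'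
        simpa using (Real.tendsto_exp_neg_atTop_nhds_zero.comp this).const_mul (h x)

/-! ### Riemann sums of difference quotients -/

/-- Comparing (1 - p)^k with (exp(-p))^k costs at most k p² = (k p) p, which tends to 0. -/
theorem tendsto_one_sub_pow_exp {p : ℕ → ℝ} {k : ℕ → ℕ} {t : ℝ}
    (hp0 : ∀ᶠ n in atTop, 0 ≤ p n) (hp1 : ∀ᶠ n in atTop, p n ≤ 1) (hp : Tendsto p atTop (𝓝 0))
    (hk : Tendsto (fun n => k n * p n) atTop (𝓝 t)) :
    Tendsto (fun n => (1 - p n) ^ k n) atTop (𝓝 (Real.exp (-t))) := by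
  have h1 : Tendsto (fun n => Real.exp (-(k n * p n))) atTop (𝓝 (Real.exp (-t))) :=
    (Real.continuous_exp.tendsto _).comp hk.neg
  have h2 : Tendsto (fun n => (k n * p n) * p n) atTop (𝓝 0) := by simpa using hk.mul hp
  have h3 : Tendsto (fun n => (1 - p n) ^ k n - Real.exp (-(k n * p n))) atTop (𝓝 0) := by
    refine squeeze_zero_norm' ?_ h2
    filter_upwards [hp0, hp1] with n h0 h1
    have e : Real.exp (-(k n * p n)) = Real.exp (-p n) ^ k n := by
      rw [← Real.exp_nat_mul]; congr 1; ring
    rw [Real.norm_eq_abs, e]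
    refine (abs_pow_sub_pow_le (1 - p n) (Real.exp (-p n)) (k n)).trans ?_
    have hb := Real.abs_exp_sub_one_sub_id_le (x := -p n) (by rw [abs_neg, abs_of_nonneg h0]; exact h1)
    have hb' : |(1 - p n) - Real.exp (-p n)| ≤ p n ^ 2 := by
      rw [abs_sub_comm]; convert hb using 1 <;> ring_nf
    have hmax : max |1 - p n| |Real.exp (-p n)| ≤ 1 := by
      refine max_le ?_ ?_
      · rw [abs_of_nonneg (by linarith)]; linarith
      · rw [abs_of_pos (Real.exp_pos _)]; exact Real.exp_le_one_iff.2 (by linarith)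
    calc _ ≤ p n ^ 2 * k n * 1 := by
          refine mul_le_mul (mul_le_mul_of_nonneg_right hb' (by positivity))
            (pow_le_one₀ (by positivity) hmax) (by positivity) (by positivity)
      _ = _ := by ring
  simpa using h3.add h1

/-- The increment of `G` over the interval `[i / m, (i + 1) / m]` that contains `x`. -/
def increment (G : ℝ → ℝ) (m : ℕ) (x : ℝ) : ℝ :=
  G ((⌊x * m⌋₊ + 1 : ℝ) / m) - G ((⌊x * m⌋₊ : ℝ) / m)

/-- The difference quotient is over an interval of length 1/m that contains `x`, so
differentiability at `x` alone suffices: the errors at both endpoints are small relative to 1/m. -/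
theorem tendsto_mul_increment {G : ℝ → ℝ} {G' x : ℝ} (hx : 0 ≤ x) (hG : HasDerivAt G G' x) :
    Tendsto (fun m : ℕ => m * increment G m x) atTop (𝓝 G') := by
  rw [Metric.tendsto_atTop]
  intro ε hε
  have ho := hG.isLittleO.def (half_pos hε)
  obtain ⟨δ, hδ, hball⟩ := Metric.eventually_nhds_iff.1 ho
  obtain ⟨M, hM⟩ := exists_nat_gt (1 / δ)
  refine ⟨M + 1, fun m hm => ?_⟩
  have hm0 : (0 : ℝ) < m := by exact_mod_cast (Nat.succ_pos M).trans_le hm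
  have hmδ : 1 / (m : ℝ) < δ := by
    rw [div_lt_comm₀ hm0 hδ]
    refine hM.trans ?_
    exact_mod_cast hm
  set u : ℝ := (⌊x * m⌋₊ : ℝ) / m with hu
  set v : ℝ := (⌊x * m⌋₊ + 1 : ℝ) / m with hv
  have hux : u ≤ x := by
    rw [hu, div_le_iff₀ hm0]; exact Nat.floor_le (by positivity)
  have hxv : x ≤ v := by
    rw [hv, le_div_iff₀ hm0]; exact (Nat.lt_floor_add_one _).le
  have huv : v = u + 1 / m := by rw [hu, hv]; ring
  have h1 := hball (y := u) (by rw [Real.dist_eq, abs_lt]; constructor <;> linarith)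
  have h2 := hball (y := v) (by rw [Real.dist_eq, abs_lt]; constructor <;> linarith)
  simp only [smul_eq_mul, Real.norm_eq_abs] at h1 h2
  rw [abs_of_nonpos (by linarith : u - x ≤ 0)] at h1
  rw [abs_of_nonneg (by linarith : 0 ≤ v - x)] at h2
  have h3 : |G v - G u - G' / m| ≤ ε / 2 / m := by
    have e1 : G v - G u - G' / m = (G v - G x - (v - x) * G') - (G u - G x - (u - x) * G') := by
      rw [huv]; ring
    have e2 : ε / 2 / m = ε / 2 * (v - x) + ε / 2 * -(u - x) := by rw [huv]; ring
    rw [e1, e2]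
    exact (abs_sub _ _).trans (add_le_add h2 h1)
  have e : m * increment G m x - G' = m * (G v - G u - G' / m) := by
    change m * (G v - G u) - G' = _
    field_simp
  rw [Real.dist_eq, e, abs_mul, abs_of_pos hm0]
  calc m * |G v - G u - G' / m| ≤ m * (ε / 2 / m) := by gcongr
    _ = ε / 2 := by field_simp
    _ < ε := half_lt_self hε

open MeasureTheory in
-- Writes sums over files as integrals over a fixed interval, so that dominated convergence applies.
theorem integral_comp_floor_mul (f : ℕ → ℝ) {m : ℕ} (hm : 0 < m) :
    m * ∫ x in Set.Ioo (0 : ℝ) 1, f ⌊x * m⌋₊ = ∑ i ∈ Finset.range m, f i := by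
  have hm0 : (0 : ℝ) < m := by exact_mod_cast hm
  have hle : ∀ k : ℕ, (k : ℝ) / m ≤ ((k + 1 : ℕ) : ℝ) / m := fun k => by
    gcongr; exact k.le_succ
  have hae : ∀ k : ℕ, (fun _ => f k) =ᵐ[volume.restrict (Set.uIoc ((k : ℝ) / m)
      (((k + 1 : ℕ) : ℝ) / m))] fun x => f ⌊x * m⌋₊ := by
    intro k
    rw [Set.uIoc_of_le (hle k), ← Measure.restrict_congr_set Ioo_ae_eq_Ioc]
    refine (ae_restrict_iff' measurableSet_Ioo).2 (Eventually.of_forall fun x hx => ?_)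
    have : ⌊x * m⌋₊ = k := by
      have h1 := (div_lt_iff₀ hm0).1 hx.1
      have h2 := (lt_div_iff₀ hm0).1 hx.2
      rw [Nat.floor_eq_iff (k.cast_nonneg.trans h1.le)]
      exact ⟨h1.le, by simpa using h2⟩
    simp only [this]
  have h := intervalIntegral.sum_integral_adjacent_intervals (μ := volume)
    (f := fun x : ℝ => f ⌊x * m⌋₊) (a := fun k : ℕ => (k : ℝ) / m) (n := m)
    fun k _ => (intervalIntegrable_const (c := f k)).congr_ae (hae k)
  simp only [Nat.cast_zero, zero_div, div_self hm0.ne'] at h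
  rw [← integral_Ioc_eq_integral_Ioo, ← intervalIntegral.integral_of_le zero_le_one, ← h,
    Finset.mul_sum]
  refine Finset.sum_congr rfl fun k _ => ?_
  rw [← intervalIntegral.integral_congr_ae_restrict (hae k), intervalIntegral.integral_const]
  push_cast
  rw [smul_eq_mul]
  field_simp
  ring

/-! ### Asymptotics of the request process of one set of files -/

/-- The distribution function of a subprobability on `[0, 1]` that is differentiable off a countable
set. -/
structure IsSubCDF (G : ℝ → ℝ) : Prop where
  monotoneOn : MonotoneOn G (Set.Icc 0 1)
  continuousOn : ContinuousOn G (Set.Icc 0 1)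
  map_zero : G 0 = 0
  map_one_pos : 0 < G 1
  map_one_le : G 1 ≤ 1
  differentiable_off_countable : ∃ D : Set ℝ, D.Countable ∧
    ∀ x ∈ Set.Ioo (0 : ℝ) 1 \ D, DifferentiableAt ℝ G x

namespace IsSubCDF

open MeasureTheory

variable {G : ℝ → ℝ}

theorem mem_Icc_div {i m : ℕ} (h : i ≤ m) : (i : ℝ) / m ∈ Set.Icc (0 : ℝ) 1 :=
  ⟨by positivity, div_le_one_of_le₀ (by exact_mod_cast h) (by positivity)⟩

theorem increment_index_mem_Icc (hG : IsSubCDF G) {i m : ℕ} (h : i < m) :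
    G ((i + 1 : ℝ) / m) - G ((i : ℝ) / m) ∈ Set.Icc (0 : ℝ) 1 := by
  have h1 : (i + 1 : ℝ) / m ∈ Set.Icc (0 : ℝ) 1 := by exact_mod_cast mem_Icc_div h
  have h0 : (i : ℝ) / m ∈ Set.Icc (0 : ℝ) 1 := mem_Icc_div h.le
  have hle := hG.monotoneOn h0 h1 (by gcongr; linarith)
  have hle1 := hG.monotoneOn h1 ⟨zero_le_one, le_rfl⟩ h1.2
  have hle0 := hG.monotoneOn ⟨le_rfl, zero_le_one⟩ h0 h0.1
  rw [hG.map_zero] at hle0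
  constructor <;> linarith [hG.map_one_le]

theorem increment_mem_Icc (hG : IsSubCDF G) {m : ℕ} (hm : 0 < m) {x : ℝ}
    (hx : x ∈ Set.Ioo (0 : ℝ) 1) : increment G m x ∈ Set.Icc (0 : ℝ) 1 := by
  refine hG.increment_index_mem_Icc ?_
  rw [Nat.floor_lt (by have := hx.1; positivity)]
  have : (0 : ℝ) < m := by exact_mod_cast hm
  nlinarith [hx.2]

theorem ae_differentiableAt (hG : IsSubCDF G) :
    ∀ᵐ x ∂volume.restrict (Set.Ioo (0 : ℝ) 1), x ∈ Set.Ioo (0 : ℝ) 1 ∧ DifferentiableAt ℝ G x := by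
  obtain ⟨D, hD, hd⟩ := hG.differentiable_off_countable
  filter_upwards [ae_restrict_mem measurableSet_Ioo,
    ae_restrict_of_ae (hD.ae_notMem volume)] with x hx hxD
  exact ⟨hx, hd x ⟨hx, hxD⟩⟩

theorem ae_deriv_nonneg (hG : IsSubCDF G) :
    ∀ᵐ x ∂volume.restrict (Set.Ioo (0 : ℝ) 1), 0 ≤ deriv G x := by
  filter_upwards [hG.ae_differentiableAt] with x ⟨hx, hd⟩
  refine ge_of_tendsto (tendsto_mul_increment hx.1.le hd.hasDerivAt) ?_
  filter_upwards [eventually_gt_atTop 0] with m hm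
  exact mul_nonneg m.cast_nonneg (hG.increment_mem_Icc hm hx).1

theorem intervalIntegrable_deriv (hG : IsSubCDF G) : IntervalIntegrable (deriv G) volume 0 1 :=
  MonotoneOn.intervalIntegrable_deriv (by rw [Set.uIcc_of_le zero_le_one]; exact hG.monotoneOn)

theorem integrable_deriv (hG : IsSubCDF G) :
    Integrable (deriv G) (volume.restrict (Set.Ioo (0 : ℝ) 1)) :=
  (intervalIntegrable_iff_integrableOn_Ioo_of_le zero_le_one).1 hG.intervalIntegrable_deriv

/-- Continuity together with differentiability off a countable set excludes a singular part, so the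
derivative carries the whole mass. -/
theorem integral_deriv (hG : IsSubCDF G) : ∫ x in Set.Ioo (0 : ℝ) 1, deriv G x = G 1 := by
  obtain ⟨D, hD, hd⟩ := hG.differentiable_off_countable
  rw [← integral_Ioc_eq_integral_Ioo, ← intervalIntegral.integral_of_le zero_le_one,
    integral_eq_of_hasDerivAt_off_countable_of_le G (deriv G) zero_le_one hD hG.continuousOn
      (fun x hx => (hd x hx).hasDerivAt) hG.intervalIntegrable_deriv, hG.map_zero, sub_zero]

/-- The limiting normalized number of distinct files in a window of normalized length `τ`. -/
def seenLimit (b : ℕ) (G : ℝ → ℝ) (τ : ℝ) : ℝ :=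
  b * ∫ x in Set.Ioo (0 : ℝ) 1, (1 - Real.exp (-(τ / b * deriv G x)))

/-- The limiting probability of a request for a file that is not in the preceding window of
normalized length `τ`. -/
def missLimit (b : ℕ) (G : ℝ → ℝ) (τ : ℝ) : ℝ :=
  ∫ x in Set.Ioo (0 : ℝ) 1, deriv G x * Real.exp (-(τ / b * deriv G x))

theorem isMissCurve (hG : IsSubCDF G) {b : ℕ} (hb : 0 < b) :
    IsMissCurve (seenLimit b G) (missLimit b G) :=
  isMissCurve_of_density hG.integrable_deriv hG.ae_deriv_nonneg
    (by rw [hG.integral_deriv]; exact hG.map_one_pos) (by exact_mod_cast hb)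

theorem measurable_increment_comp (φ : ℝ → ℝ) (m : ℕ) :
    Measurable fun x => φ (increment G m x) :=
  (measurable_from_nat (f := fun i : ℕ => φ (G ((i + 1 : ℝ) / m) - G ((i : ℝ) / m)))).comp
    (Nat.measurable_floor.comp (measurable_id.mul_const _))

theorem sum_popularity (φ : ℝ → ℝ) {m : ℕ} (hm : 0 < m) :
    ∑ i : Fin m, φ (popularity G m i) =
      m * ∫ x in Set.Ioo (0 : ℝ) 1, φ (increment G m x) := by
  have h := integral_comp_floor_mul
    (fun i : ℕ => φ (G ((i + 1 : ℝ) / m) - G ((i : ℝ) / m))) hm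
  rw [← Fin.sum_univ_eq_sum_range] at h
  exact h.symm

theorem sum_popularity_eq (hG : IsSubCDF G) {m : ℕ} (hm : 0 < m) :
    ∑ i : Fin m, popularity G m i = G 1 := by
  have hm0 : (m : ℝ) ≠ 0 := by exact_mod_cast hm.ne'
  have := Finset.sum_range_sub (fun i : ℕ => G ((i : ℝ) / m)) m
  rw [div_self hm0, Nat.cast_zero, zero_div, hG.map_zero, sub_zero] at this
  rw [← this, ← Fin.sum_univ_eq_sum_range (fun i : ℕ => G (((i + 1 : ℕ) : ℝ) / m) - G ((i : ℝ) / m))]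
  simp [popularity]

theorem tendsto_floor_mul_increment {b : ℕ} (hb : 0 < b) {τ x : ℝ} (hτ : 0 ≤ τ) (hx : 0 ≤ x)
    (hd : DifferentiableAt ℝ G x) :
    Tendsto (fun n : ℕ => ⌊τ * n⌋₊ * increment G (b * n) x) atTop (𝓝 (τ / b * deriv G x)) := by
  have hbn : Tendsto (fun n : ℕ => b * n) atTop atTop := tendsto_id.const_mul_atTop' hb
  have h1 := (tendsto_mul_increment hx hd.hasDerivAt).comp hbn
  have h2 : Tendsto (fun n : ℕ => (⌊τ * n⌋₊ : ℝ) / n) atTop (𝓝 τ) :=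
    (tendsto_nat_floor_mul_div_atTop hτ).comp tendsto_natCast_atTop_atTop
  refine ((h2.div_const (b : ℝ)).mul h1).congr' ?_
  filter_upwards [eventually_gt_atTop 0] with n hn
  have hn0 : (n : ℝ) ≠ 0 := by exact_mod_cast hn.ne'
  have hb0 : (b : ℝ) ≠ 0 := by exact_mod_cast hb.ne'
  simp only [Function.comp_apply, Nat.cast_mul]
  field_simp

theorem tendsto_one_sub_increment_pow (hG : IsSubCDF G) {b : ℕ} (hb : 0 < b) {τ x : ℝ} (hτ : 0 ≤ τ)
    (hx : x ∈ Set.Ioo (0 : ℝ) 1) (hd : DifferentiableAt ℝ G x) :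
    Tendsto (fun n : ℕ => (1 - increment G (b * n) x) ^ ⌊τ * n⌋₊) atTop
      (𝓝 (Real.exp (-(τ / b * deriv G x)))) := by
  have hbn : Tendsto (fun n : ℕ => b * n) atTop atTop := tendsto_id.const_mul_atTop' hb
  have hmem : ∀ᶠ n : ℕ in atTop, increment G (b * n) x ∈ Set.Icc (0 : ℝ) 1 := by
    filter_upwards [eventually_gt_atTop 0] with n hn
    exact hG.increment_mem_Icc (Nat.mul_pos hb hn) hx
  refine tendsto_one_sub_pow_exp (hmem.mono fun n h => h.1) (hmem.mono fun n h => h.2) ?_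
    (tendsto_floor_mul_increment hb hτ hx.1.le hd)
  have h0 : Tendsto (fun m : ℕ => increment G m x) atTop (𝓝 0) := by
    have := (tendsto_mul_increment hx.1.le hd.hasDerivAt).mul
      (tendsto_inv_atTop_nhds_zero_nat (𝕜 := ℝ))
    rw [mul_zero] at this
    refine this.congr' ?_
    filter_upwards [eventually_gt_atTop 0] with m hm
    have hm0 : (m : ℝ) ≠ 0 := by exact_mod_cast hm.ne'
    field_simp
  exact h0.comp hbn

theorem tendsto_seenLimit (hG : IsSubCDF G) {b : ℕ} (hb : 0 < b) {τ : ℝ} (hτ : 0 ≤ τ) :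
    Tendsto (fun n : ℕ => (∑ i : Fin (b * n),
      (1 - (1 - popularity G (b * n) i) ^ ⌊τ * n⌋₊)) / n) atTop (𝓝 (seenLimit b G τ)) := by
  have key : Tendsto (fun n : ℕ => b * ∫ x in Set.Ioo (0 : ℝ) 1,
      (1 - (1 - increment G (b * n) x) ^ ⌊τ * n⌋₊)) atTop (𝓝 (seenLimit b G τ)) := by
    refine Tendsto.const_mul _ ?_
    refine tendsto_integral_filter_of_dominated_convergence (fun _ => 1)
      (Eventually.of_forall fun n => (measurable_increment_comp
        (fun p => 1 - (1 - p) ^ ⌊τ * n⌋₊) (b * n)).aestronglyMeasurable) ?_ (integrable_const _) ?_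
    · filter_upwards [eventually_gt_atTop 0] with n hn
      filter_upwards [ae_restrict_mem measurableSet_Ioo] with x hx
      obtain ⟨h0, h1⟩ := hG.increment_mem_Icc (Nat.mul_pos hb hn) hx
      have h2 : 0 ≤ (1 - increment G (b * n) x) ^ ⌊τ * n⌋₊ := pow_nonneg (by linarith) _
      have h3 : (1 - increment G (b * n) x) ^ ⌊τ * n⌋₊ ≤ 1 :=
        pow_le_one₀ (by linarith) (by linarith)
      rw [Real.norm_eq_abs, abs_le]
      constructor <;> linarith
    · filter_upwards [hG.ae_differentiableAt] with x ⟨hx, hd⟩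
      exact tendsto_const_nhds.sub (hG.tendsto_one_sub_increment_pow hb hτ hx hd)
  refine key.congr' ?_
  filter_upwards [eventually_gt_atTop 0] with n hn
  have hn0 : (n : ℝ) ≠ 0 := by exact_mod_cast hn.ne'
  rw [sum_popularity (fun p => 1 - (1 - p) ^ ⌊τ * n⌋₊) (Nat.mul_pos hb hn)]
  push_cast
  field_simp

theorem tendsto_missLimit (hG : IsSubCDF G) {b : ℕ} (hb : 0 < b) {τ : ℝ} (hτ : 0 ≤ τ) :
    Tendsto (fun n : ℕ => ∑ i : Fin (b * n),
      popularity G (b * n) i * (1 - popularity G (b * n) i) ^ ⌊τ * n⌋₊) atTop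
      (𝓝 (missLimit b G τ)) := by
  have hb0 : (0 : ℝ) < b := by exact_mod_cast hb
  -- The dominating constant below degenerates at `τ = 0`; there the sum telescopes to `G 1`.
  rcases hτ.eq_or_lt with rfl | hpos
  · have e : missLimit b G 0 = G 1 := by simp [missLimit, hG.integral_deriv]
    rw [e]
    refine tendsto_const_nhds.congr' ?_
    filter_upwards [eventually_gt_atTop 0] with n hn
    simp [hG.sum_popularity_eq (Nat.mul_pos hb hn)]
  have hbn : Tendsto (fun n : ℕ => b * n) atTop atTop := tendsto_id.const_mul_atTop' hb
  have hfl : Tendsto (fun n : ℕ => (⌊τ * n⌋₊ : ℝ) / n) atTop (𝓝 τ) :=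
    (tendsto_nat_floor_mul_div_atTop hτ).comp tendsto_natCast_atTop_atTop
  have key : Tendsto (fun n : ℕ => ∫ x in Set.Ioo (0 : ℝ) 1, ((b * n : ℕ) : ℝ) *
      (increment G (b * n) x * (1 - increment G (b * n) x) ^ ⌊τ * n⌋₊)) atTop
      (𝓝 (missLimit b G τ)) := by
    -- The derivative may be unbounded, but y (1 - y)^k ≤ 1/k for an increment y. Since eventually k
    -- ≥ τn/2, multiplying by bn gives at most 2b/τ.
    refine tendsto_integral_filter_of_dominated_convergence (fun _ => 2 * b / τ)
      (Eventually.of_forall fun n => ((measurable_increment_comp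
        (fun p => p * (1 - p) ^ ⌊τ * n⌋₊) (b * n)).const_mul _).aestronglyMeasurable) ?_
      (integrable_const _) ?_
    · filter_upwards [eventually_gt_atTop 0,
        hfl.eventually_const_lt (half_lt_self hpos)] with n hn hfn
      filter_upwards [ae_restrict_mem measurableSet_Ioo] with x hx
      have hn0 : (0 : ℝ) < n := by exact_mod_cast hn
      rw [lt_div_iff₀ hn0] at hfn
      obtain ⟨h0, h1⟩ := hG.increment_mem_Icc (Nat.mul_pos hb hn) hx
      set y := increment G (b * n) x
      set k := ⌊τ * n⌋₊
      have h2 : 0 ≤ (1 - y) ^ k := pow_nonneg (by linarith) _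
      have h3 : (k * y) * (1 - y) ^ k ≤ 1 := by
        calc (k * y) * (1 - y) ^ k ≤ Real.exp (k * y) * Real.exp (-y) ^ k := by
              refine mul_le_mul (by linarith [Real.add_one_le_exp (k * y)])
                (pow_le_pow_left₀ (by linarith) (Real.one_sub_le_exp_neg y) k) h2
                (Real.exp_pos _).le
          _ = 1 := by
              rw [← Real.exp_nat_mul, ← Real.exp_add]; simp
      rw [Real.norm_of_nonneg (by positivity), le_div_iff₀ hpos]
      push_cast
      have h4 : τ / 2 * n * (y * (1 - y) ^ k) ≤ k * (y * (1 - y) ^ k) :=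
        mul_le_mul_of_nonneg_right hfn.le (mul_nonneg h0 h2)
      calc (b * n * (y * (1 - y) ^ k)) * τ = 2 * b * (τ / 2 * n * (y * (1 - y) ^ k)) := by ring
        _ ≤ 2 * b * 1 := by
          refine mul_le_mul_of_nonneg_left ?_ (by positivity)
          linarith
        _ = 2 * b := mul_one _
    · filter_upwards [hG.ae_differentiableAt] with x ⟨hx, hd⟩
      refine (((tendsto_mul_increment hx.1.le hd.hasDerivAt).comp hbn).mul
        (hG.tendsto_one_sub_increment_pow hb hτ hx hd)).congr fun n => ?_
      simp only [Function.comp_apply]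
      ring
  refine key.congr' ?_
  filter_upwards [eventually_gt_atTop 0] with n hn
  rw [sum_popularity (fun p => p * (1 - p) ^ ⌊τ * n⌋₊) (Nat.mul_pos hb hn),
    integral_const_mul]

end IsSubCDF

/-! ### The two strategies -/

theorem IsPopularityCDF.const_mul_isSubCDF {F : ℝ → ℝ} (hF : IsPopularityCDF F) {c : ℝ}
    (hc : 0 < c) (hc1 : c ≤ 1) : IsSubCDF (fun x => c * F x) where
  monotoneOn := fun _ hx _ hy hxy => mul_le_mul_of_nonneg_left (hF.monotoneOn hx hy hxy) hc.le
  continuousOn := continuousOn_const.mul hF.continuousOn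
  map_zero := by simp [hF.map_zero]
  map_one_pos := by simpa [hF.map_one] using hc
  map_one_le := by simpa [hF.map_one] using hc1
  differentiable_off_countable := by
    obtain ⟨D, hD, hd, -⟩ := hF.contDiff_off_countable
    exact ⟨D, hD, fun x hx => (hd x hx).const_mul c⟩

theorem IsSubCDF.add {F G : ℝ → ℝ} (hF : IsSubCDF F) (hG : IsSubCDF G) (h : F 1 + G 1 ≤ 1) :
    IsSubCDF (fun x => F x + G x) where
  monotoneOn := fun _ hx _ hy hxy => add_le_add (hF.monotoneOn hx hy hxy) (hG.monotoneOn hx hy hxy)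
  continuousOn := hF.continuousOn.add hG.continuousOn
  map_zero := by simp [hF.map_zero, hG.map_zero]
  map_one_pos := add_pos hF.map_one_pos hG.map_one_pos
  map_one_le := h
  differentiable_off_countable := by
    obtain ⟨D, hD, hd⟩ := hF.differentiable_off_countable
    obtain ⟨E, hE, he⟩ := hG.differentiable_off_countable
    exact ⟨D ∪ E, hD.union hE, fun x hx => (hd x ⟨hx.1, fun h => hx.2 (Or.inl h)⟩).add
      (he x ⟨hx.1, fun h => hx.2 (Or.inr h)⟩)⟩

theorem sum_slice_sigma_fst {κ : Type*} [Fintype κ] [DecidableEq κ] {α : κ → Type*}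
    [∀ k, Fintype (α k)] (f : (Σ k, α k) → ℝ) (k : κ) :
    ∑ x ∈ slice (fun x : Σ k, α k => x.1) k, f x = ∑ i, f ⟨k, i⟩ := by
  rw [slice, Finset.sum_filter, Fintype.sum_sigma, Finset.sum_eq_single k]
  · simp
  · intro l _ hl
    simp [hl]
  · simp

namespace Workload

variable (W : Workload)

theorem totalRate_eq : W.totalRate =
    W.sharedRate 0 + W.sharedRate 1 + (W.privateRate 0 + W.privateRate 1) := by
  simp [totalRate, Fin.sum_univ_two]; ring

theorem totalRate_pos : 0 < W.totalRate := by
  rw [totalRate_eq]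
  linarith [W.sharedRate_pos 0, W.sharedRate_pos 1, W.privateRate_pos 0, W.privateRate_pos 1]

/-- The distribution function of the requests to `S k`, as a subprobability. -/
def sliceCDF : Fin 3 → ℝ → ℝ
  | 0 => fun x => W.sharedRate 0 / W.totalRate * W.sharedCDF 0 x +
      W.sharedRate 1 / W.totalRate * W.sharedCDF 1 x
  | 1 => fun x => W.privateRate 0 / W.totalRate * W.privateCDF 0 x
  | 2 => fun x => W.privateRate 1 / W.totalRate * W.privateCDF 1 x

theorem fileProb_eq_popularity (n : ℕ) (k : Fin 3) (i : Fin (W.b k * n)) :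
    W.fileProb n ⟨k, i⟩ = popularity (W.sliceCDF k) (W.b k * n) i := by
  match k, i with
  | 0, i | 1, i | 2, i =>
    simp only [fileProb, fileRate, popularity, sliceCDF, Fin.sum_univ_two]
    ring

theorem isSubCDF_sliceCDF (k : Fin 3) : IsSubCDF (W.sliceCDF k) := by
  have hT := W.totalRate_pos
  have e := W.totalRate_eq
  have h0 := W.sharedRate_pos 0
  have h1 := W.sharedRate_pos 1
  have h2 := W.privateRate_pos 0
  have h3 := W.privateRate_pos 1
  fin_cases k
  · refine ((W.sharedCDF_spec 0).const_mul_isSubCDF (div_pos h0 hT) ?_).add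
      ((W.sharedCDF_spec 1).const_mul_isSubCDF (div_pos h1 hT) ?_) ?_
    · rw [div_le_one hT]; linarith
    · rw [div_le_one hT]; linarith
    · rw [(W.sharedCDF_spec 0).map_one, (W.sharedCDF_spec 1).map_one, mul_one, mul_one, ← add_div,
        div_le_one hT]
      linarith
  · exact (W.privateCDF_spec 0).const_mul_isSubCDF (div_pos h2 hT)
      (by rw [div_le_one hT]; linarith)
  · exact (W.privateCDF_spec 1).const_mul_isSubCDF (div_pos h3 hT)
      (by rw [div_le_one hT]; linarith)

theorem sum_sliceCDF_one : ∑ k, W.sliceCDF k 1 = 1 := by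
  rw [Fin.sum_univ_three]
  simp only [sliceCDF, (W.sharedCDF_spec _).map_one, (W.privateCDF_spec _).map_one, mul_one]
  rw [← add_div, ← add_div, ← add_div, div_eq_one_iff_eq W.totalRate_pos.ne', totalRate_eq]
  ring

/-- For `n = 0` there are no files and the sum is 0. -/
theorem fileProb_isProbability {n : ℕ} (hn : 0 < n) :
    (∀ f, 0 ≤ W.fileProb n f) ∧ ∑ f, W.fileProb n f = 1 := by
  constructor
  · rintro ⟨k, i⟩
    rw [fileProb_eq_popularity]
    exact ((W.isSubCDF_sliceCDF k).increment_index_mem_Icc i.2).1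
  · rw [Fintype.sum_sigma, ← W.sum_sliceCDF_one]
    refine Finset.sum_congr rfl fun k _ => ?_
    simp only [fileProb_eq_popularity]
    exact (W.isSubCDF_sliceCDF k).sum_popularity_eq (Nat.mul_pos (W.b_pos k) hn)

theorem card_file (n : ℕ) : (Fintype.card (W.File n) : ℝ) = (∑ k, (W.b k : ℝ)) * n := by
  simp [Finset.sum_mul]

theorem card_slice_le {P : Type*} [DecidableEq P] (n : ℕ) (part : W.File n → P) (q : P) :
    ((slice part q).card : ℝ) ≤ (∑ k, (W.b k : ℝ)) * n := by
  rw [← card_file]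
  exact_mod_cast Finset.card_le_univ _

/-- The limiting normalized number of distinct files of `S k` in a window of length `τ`. -/
def seenLimit (k : Fin 3) : ℝ → ℝ := IsSubCDF.seenLimit (W.b k) (W.sliceCDF k)

/-- The limiting probability of a request for a file of `S k` not requested in a window of length
`τ`. -/
def missLimit (k : Fin 3) : ℝ → ℝ := IsSubCDF.missLimit (W.b k) (W.sliceCDF k)

theorem isMissCurve (k : Fin 3) : IsMissCurve (W.seenLimit k) (W.missLimit k) :=
  (W.isSubCDF_sliceCDF k).isMissCurve (W.b_pos k)

theorem isMissCurve_sum :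
    IsMissCurve (fun τ => ∑ k, W.seenLimit k τ) (fun τ => ∑ k, W.missLimit k τ) :=
  IsMissCurve.sum W.isMissCurve

theorem tendsto_sum_seen (k : Fin 3) {τ : ℝ} (hτ : 0 ≤ τ) :
    Tendsto (fun n : ℕ => (∑ i : Fin (W.b k * n), (1 - (1 - W.fileProb n ⟨k, i⟩) ^ ⌊τ * n⌋₊)) / n)
      atTop (𝓝 (W.seenLimit k τ)) := by
  simp only [fileProb_eq_popularity]
  exact (W.isSubCDF_sliceCDF k).tendsto_seenLimit (W.b_pos k) hτ

theorem tendsto_sum_miss (k : Fin 3) {τ : ℝ} (hτ : 0 ≤ τ) :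
    Tendsto (fun n : ℕ => ∑ i : Fin (W.b k * n),
      W.fileProb n ⟨k, i⟩ * (1 - W.fileProb n ⟨k, i⟩) ^ ⌊τ * n⌋₊)
      atTop (𝓝 (W.missLimit k τ)) := by
  simp only [fileProb_eq_popularity]
  exact (W.isSubCDF_sliceCDF k).tendsto_missLimit (W.b_pos k) hτ

/-- With a single slice the same window length `τ` applies to all three sets, so their curves add
up. -/
theorem isAsymptoticMiss1 {β : ℝ} (hβ : 0 ≤ β) : W.IsAsymptoticMiss1 β
    (missCurve (fun τ => ∑ k, W.seenLimit k τ) (fun τ => ∑ k, W.missLimit k τ) β) := by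
  intro C hC
  have hs : ∀ n, slice (fun _ : W.File n => ()) () = Finset.univ := fun n => by simp [slice]
  have := tendsto_missProb (part := fun n (_ : W.File n) => ()) (C := fun n _ => C n)
    (p := W.fileProb) (fun _ : Unit => W.isMissCurve_sum) (s := fun _ => β)
    (fun _ => hβ) ((eventually_gt_atTop 0).mono fun n hn => W.fileProb_isProbability hn)
    (fun n q => W.card_slice_le n _ q) (fun _ τ hτ => ?_) (fun _ τ hτ => ?_) (fun _ => hC)
  · rw [Fintype.sum_unique] at this
    exact this
  · simp only [meanSeen, hs, Fintype.sum_sigma, Finset.sum_div]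
    refine tendsto_finsetSum _ fun k _ => ?_
    simpa only [Finset.sum_div] using W.tendsto_sum_seen k hτ
  · simp only [missRecent, hs, Fintype.sum_sigma]
    exact tendsto_finsetSum _ fun k _ => W.tendsto_sum_miss k hτ

theorem isAsymptoticMiss3 {s : Fin 3 → ℝ} (hs : ∀ k, 0 ≤ s k) : W.IsAsymptoticMiss3 s
    (∑ k, missCurve (W.seenLimit k) (W.missLimit k) (s k)) := by
  intro c hc
  refine tendsto_missProb (part := fun n (f : W.File n) => f.1) (C := c)
    (p := W.fileProb) W.isMissCurve hs
    ((eventually_gt_atTop 0).mono fun n hn => W.fileProb_isProbability hn)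
    (fun n q => W.card_slice_le n _ q) (fun k τ hτ => ?_) (fun k τ hτ => ?_) hc
  · simp only [meanSeen, sum_slice_sigma_fst]
    exact W.tendsto_sum_seen k hτ
  · simp only [missRecent, sum_slice_sigma_fst]
    exact W.tendsto_sum_miss k hτ

theorem exists_isMinOn_missCurve {β : ℝ} (hβ : 0 ≤ β) :
    ∃ s ∈ {s : Fin 3 → ℝ | (∀ k, 0 ≤ s k) ∧ ∑ k, s k ≤ β},
      IsMinOn (fun s : Fin 3 → ℝ => ∑ k, missCurve (W.seenLimit k) (W.missLimit k) (s k))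
        {s : Fin 3 → ℝ | (∀ k, 0 ≤ s k) ∧ ∑ k, s k ≤ β} s := by
  refine LowerSemicontinuousOn.exists_isMinOn ⟨0, by simp, by simpa using hβ⟩ ?_ ?_
  · refine (isCompact_Icc (a := (0 : Fin 3 → ℝ)) (b := fun _ => β)).of_isClosed_subset ?_ ?_
    · rw [Set.ofPred_and, Set.ofPred_forall]
      exact (isClosed_iInter fun k => isClosed_le continuous_const (continuous_apply k)).inter
        (isClosed_le (by fun_prop) continuous_const)
    · rintro s ⟨h0, h1⟩
      exact ⟨h0, fun k => (Finset.single_le_sum (fun i _ => h0 i) (Finset.mem_univ k)).trans h1⟩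
  · refine LowerSemicontinuous.lowerSemicontinuousOn ?_ _
    exact lowerSemicontinuous_sum fun k _ =>
      (W.isMissCurve k).lowerSemicontinuous_missCurve.comp (continuous_apply k)

end Workload

end

/-- For every normalized cache size `β` the asymptotic miss probabilities of Strategy 1 and of
Strategy 3 (for every choice of normalized slice sizes) exist, there is an optimal choice of slice
sizes of total at most `β` for Strategy 3, and the optimum `μ₃` is at most the asymptotic miss
probability `μ₁` of Strategy 1. -/
theorem theorem4 (W : Workload) (β : ℝ) (hβ : 0 ≤ β) :
    ∃ (μ₁ μ₃ : ℝ) (M : (Fin 3 → ℝ) → ℝ),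
      W.IsAsymptoticMiss1 β μ₁ ∧
      (∀ s : Fin 3 → ℝ, (∀ k, 0 ≤ s k) → W.IsAsymptoticMiss3 s (M s)) ∧
      IsLeast (M '' {s : Fin 3 → ℝ | (∀ k, 0 ≤ s k) ∧ ∑ k, s k ≤ β}) μ₃ ∧
      μ₃ ≤ μ₁ := by
  obtain ⟨s, hs, hmin⟩ := W.exists_isMinOn_missCurve hβ
  refine ⟨_, _, fun s => ∑ k, missCurve (W.seenLimit k) (W.missLimit k) (s k),
    W.isAsymptoticMiss1 hβ, fun s hs => W.isAsymptoticMiss3 hs,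
    ⟨⟨s, hs, rfl⟩, ?_⟩, ?_⟩
  · rintro _ ⟨t, ht, rfl⟩
    exact hmin ht
  -- Each slice gets the space that its set occupies in a shared window of length `τ`; this split
  -- misses exactly as often as the shared cache with that window.
  have le_miss : ∀ τ, 0 ≤ τ → ∑ k, W.seenLimit k τ ≤ β →
      ∑ k, missCurve (W.seenLimit k) (W.missLimit k) (s k) ≤ ∑ k, W.missLimit k τ := by
    intro τ hτ hle
    have hmem : (fun k => W.seenLimit k τ) ∈
        {s : Fin 3 → ℝ | (∀ k, 0 ≤ s k) ∧ ∑ k, s k ≤ β} := by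
      refine ⟨fun k => ?_, hle⟩
      rw [← (W.isMissCurve k).map_zero]
      exact (W.isMissCurve k).strictMonoOn.monotoneOn (Set.mem_Ici.2 le_rfl) hτ hτ
    refine (hmin hmem).trans_eq (Finset.sum_congr rfl fun k _ => ?_)
    exact (W.isMissCurve k).missCurve_apply hτ
  rcases W.isMissCurve_sum.exists_eq_or_forall_lt hβ with ⟨τ, hτ, h⟩ | h
  · have := W.isMissCurve_sum.missCurve_apply hτ
    rw [h] at this
    rw [this]
    exact le_miss τ hτ h.le
  -- Here `β` exceeds what any window occupies, so letting `τ` tend to infinity bounds the optimum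
  -- by 0.
  · refine le_trans (ge_of_tendsto W.isMissCurve_sum.tendsto_atTop ?_)
      (W.isMissCurve_sum.missCurve_nonneg β)
    filter_upwards [eventually_ge_atTop 0] with τ hτ
    exact le_miss τ hτ (h τ hτ).le
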